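/- Consider the square grid whose cells are the points $(x,y)$ with non-negative integer coordinates. A shape $S$ of order $n$ is a set of $n$ (occupied) cells. Its associated graph $G(S)$ has the cells of $S$ as vertices, two distinct cells being adjacent iff each of their coordinates differs by at most $1$ (horizontal, vertical or diagonal neighbours). $S$ is connected iff $G(S)$ is connected, and Hamiltonian iff $G(S)$ has a Hamiltonian path, that is, a path from some $u\in S$ to some $v\in S$, $v\neq u$, visiting every cell of $S$ exactly once. A line move takes $k\ge 1$ consecutive occupied cells $(x,y),(x+1,y),\dots,(x+k-1,y)$ of a row such that the cell $(x+k,y)$ is empty, and moves these $k$ nodes simultaneously to $(x+1,y),\dots,(x+k,y)$, all other nodes staying in place; moves to the left, up and down are defined symmetrically (no node may leave the grid). Shapes are regarded up to translation, that is, the target shape may be formed at any position of the grid. A straight line is a shape consisting of consecutive cells of one row or of one column. **Theorem.** There is a constant $C$ such that for every $n$ and all Hamiltonian shapes $S_I,S_F$ of the same order $n$, there is a sequence of at most $C\,n\log_2 n$ line moves that transforms $S_I$ first into a straight line and then into (a translate of) $S_F$, all shapes occurring during the sequence being connected. Likewise, $S_F$ can be transformed into (a translate of) $S_I$, through a straight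 line and through connected shapes only, by at most $C\,n\log_2 n$ line moves. -/

import Mathlib

/-- A cell of the square grid: non-negative integer coordinates `(column, row)`. -/
abbrev Cell : Type := ℕ × ℕ

/-- A shape is a finite set of (occupied) cells; its order is its cardinality.
Every node of the shape occupies exactly one cell. -/
abbrev Shape : Type := Finset Cell

/-- Two distinct cells are neighbours if both their coordinates differ by at most one
(vertical, horizontal or diagonal adjacency). -/
def Cell.Neighbour (u v : Cell) : Prop :=
  u ≠ v ∧ u.1 ≤ v.1 + 1 ∧ v.1 ≤ u.1 + 1 ∧ u.2 ≤ v.2 + 1 ∧ v.2 ≤ u.2 + 1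

/-- The associated graph `G(S)` of a shape: its vertices are the nodes of `S`, its edges join
neighbouring nodes. -/
def Shape.graph (S : Shape) : SimpleGraph {u : Cell // u ∈ S} where
  Adj u v := Cell.Neighbour u.1 v.1
  symm := ⟨fun _ _ h => ⟨h.1.symm, h.2.2.1, h.2.1, h.2.2.2.2, h.2.2.2.1⟩⟩
  loopless := ⟨fun _ h => h.1 rfl⟩

/-- A shape is connected if its associated graph is. -/
def Shape.IsConnected (S : Shape) : Prop := S.graph.Connected

/-- A shape is Hamiltonian if its associated graph has a Hamiltonian path: a path from a node `u`
to a node `v ≠ u` that visits every node exactly once. -/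
def Shape.IsHamiltonianShape (S : Shape) : Prop :=
  ∃ (u v : {u : Cell // u ∈ S}) (p : S.graph.Walk u v), u ≠ v ∧ p.IsHamiltonian

/-- The horizontal line of length `k` with leftmost cell `(x, y)`. -/
def hLine (x y k : ℕ) : Shape := (Finset.range k).image fun i => (x + i, y)

/-- The vertical line of length `k` whose cell of smallest row index is `(x, y)`. -/
def vLine (x y k : ℕ) : Shape := (Finset.range k).image fun i => (x, y + i)

/-- `LineMove S S'`: the shape `S'` arises from `S` by one permissible line move.  A line of
`k ≥ 1` nodes of `S` moves one position along its own direction; the one cell that it newly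
enters has to be empty.  The line need not be maximal, and all other nodes stay in place. -/
inductive LineMove (S : Shape) : Shape → Prop
  | right (x y k : ℕ) (hk : 1 ≤ k) (hL : hLine x y k ⊆ S) (he : (x + k, y) ∉ S) :
      LineMove S ((S \ hLine x y k) ∪ hLine (x + 1) y k)
  | left (x y k : ℕ) (hk : 1 ≤ k) (hL : hLine (x + 1) y k ⊆ S) (he : (x, y) ∉ S) :
      LineMove S ((S \ hLine (x + 1) y k) ∪ hLine x y k)
  | up (x y k : ℕ) (hk : 1 ≤ k) (hL : vLine x y k ⊆ S) (he : (x, y + k) ∉ S) :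
      LineMove S ((S \ vLine x y k) ∪ vLine x (y + 1) k)
  | down (x y k : ℕ) (hk : 1 ≤ k) (hL : vLine x (y + 1) k ⊆ S) (he : (x, y) ∉ S) :
      LineMove S ((S \ vLine x (y + 1) k) ∪ vLine x y k)

/-- `ConnectedTransformation m A B`: a sequence of exactly `m` line moves leads from `A` to `B`,
and every shape that occurs on the way (`A` and `B` included) is connected. -/
def ConnectedTransformation (m : ℕ) (A B : Shape) : Prop :=
  ∃ c : ℕ → Shape, c 0 = A ∧ c m = B ∧
    (∀ i < m, LineMove (c i) (c (i + 1))) ∧ ∀ i ≤ m, (c i).IsConnected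

/-- `A` and `B` are translates of each other (equal up to their position on the grid). -/
def IsTranslate (A B : Shape) : Prop :=
  ∃ a b : Cell, A.image (fun u => u + a) = B.image (fun u => u + b)

/-- A straight line: consecutive cells of one row or of one column. -/
def Shape.IsStraightLine (S : Shape) : Prop :=
  ∃ x y : ℕ, S = hLine x y S.card ∨ S = vLine x y S.card

/-- `TransformsThroughLine b A B`: connectivity-preserving line moves, at most `b` in total,
transform `A` into a straight line and that line into the shape `B` (placed somewhere on the
grid). -/
def TransformsThroughLine (b : ℝ) (A B : Shape) : Prop :=
  ∃ (L B' : Shape) (m₁ m₂ : ℕ), L.IsStraightLine ∧ IsTranslate B B' ∧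
    ConnectedTransformation m₁ A L ∧ ConnectedTransformation m₂ L B' ∧ ((m₁ + m₂ : ℕ) : ℝ) ≤ b

/-!
A Hamiltonian shape is straightened by divide and conquer along its Hamiltonian path; as line moves
are reversible, two straightened shapes can be joined through a common line.

Seen as a set of cells, a line move vacates one end of a line and fills the cell beyond its other
end (`Shift`).  A line that is to be moved lies over an environment `E`, the connected set of all
other cells: the relation `Ray E c S` says that `S` consists of `E` and of the cells of the row of
`c` from `c` up to some column.  Cells of `E` in that row are passed over at no cost, so that
nothing is ever in the way, and a ray is determined by `E`, `c` and its number of cells.  As `E` is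
connected and contains `c`, rays are connected.  The only danger is a cell of `E` that is vacated
for one move; this is harmless if that cell is the junction of a T of occupied cells
(`Conn.erase`), since all its neighbours then remain joined by the three arms.

Moving a ray from `c` to `c'`, both in `E`, takes a number of moves linear in its length as long as
the distance is less than about half the length (`transport_short`): one builds a bridge out of
cells of the line, a column just to the right of the lower one of `c` and `c'` together with a
piece of the upper row, and passes the line over it, cell by cell, through the two T junctions at
the ends of the column.  Taking steps of this size, a ray follows a walk in `E` of length `m` in a
number of moves linear in `m` and in the length of the ray (`transport_walk`).

Now let a path `Q` end in `c' ∈ F`, and let a line of two spare cells start at the first cell of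
`Q`, over the environment `F ∪ Q`.  Straightening the first half of `Q`, over the environment of
`F` and the second half, moving the line obtained to `c'`, bringing two of its cells back to the
start of the second half and straightening that half as well costs `T(m) = 2 T(m / 2) + O(m)`
moves, and leaves a single line that starts in `c'` over the environment `F` (`straighten_walk`).
The two spare cells come from the first two cells of the path (`exists_line_of_pair`).  With two
cells rather than one, a line can be handed on between near cells of any environment
(`transport_near`).

The lines obtained from the two shapes are brought to a common position by `O(n)` moves, turning
the line to a vertical one whenever it has to climb (`reach_row`).
-/

namespace LineMoves

/-! ### Connectedness -/

/-- Two cells are near if both coordinates differ by at most one; a cell is near itself. -/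
def Near (u v : Cell) : Prop :=
  u.1 ≤ v.1 + 1 ∧ v.1 ≤ u.1 + 1 ∧ u.2 ≤ v.2 + 1 ∧ v.2 ≤ u.2 + 1

lemma Near.symm {u v : Cell} (h : Near u v) : Near v u := ⟨h.2.1, h.1, h.2.2.2, h.2.2.1⟩

lemma Near.refl (u : Cell) : Near u u := by unfold Near; omega

/-- `u` and `v` are joined by a sequence of cells of `S`, consecutive ones being near. -/
def Linked (S : Shape) : Cell → Cell → Prop :=
  Relation.ReflTransGen fun a b => a ∈ S ∧ b ∈ S ∧ Near a b

lemma Linked.symm {S : Shape} {u v : Cell} (h : Linked S u v) : Linked S v u := by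
  induction h with
  | refl => exact .refl
  | tail _ h ih => exact .head ⟨h.2.1, h.1, h.2.2.symm⟩ ih

lemma Linked.mono {S T : Shape} (hST : S ⊆ T) {u v : Cell} (h : Linked S u v) : Linked T u v :=
  Relation.ReflTransGen.mono (r := fun a b => a ∈ S ∧ b ∈ S ∧ Near a b)
    (fun _ _ h => ⟨hST h.1, hST h.2.1, h.2.2⟩) _ _ h

lemma Linked.of_near {S : Shape} {u v : Cell} (hu : u ∈ S) (hv : v ∈ S) (h : Near u v) :
    Linked S u v := .single ⟨hu, hv, h⟩

/-- Connectedness of a shape, with chains of near cells in place of walks in `G(S)`. -/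
def Conn (S : Shape) : Prop := S.Nonempty ∧ ∀ u ∈ S, ∀ v ∈ S, Linked S u v

lemma conn_of_hub {S : Shape} {g : Cell} (hg : g ∈ S) (h : ∀ v ∈ S, Linked S v g) : Conn S :=
  ⟨⟨g, hg⟩, fun u hu v hv => (h u hu).trans (h v hv).symm⟩

lemma conn_singleton (c : Cell) : Conn {c} :=
  conn_of_hub (Finset.mem_singleton_self c) fun v hv => by
    rw [Finset.mem_singleton] at hv; subst hv; exact .refl

lemma Conn.union {A B : Shape} (hA : Conn A) (hB : Conn B) {a b : Cell} (ha : a ∈ A) (hb : b ∈ B)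
    (h : Near a b) : Conn (A ∪ B) := by
  refine conn_of_hub (Finset.mem_union_left B ha) fun v hv => ?_
  rcases Finset.mem_union.1 hv with hv | hv
  · exact (hA.2 v hv a ha).mono Finset.subset_union_left
  · exact ((hB.2 v hv b hb).mono Finset.subset_union_right).trans
      (Linked.of_near (Finset.mem_union_right A hb) (Finset.mem_union_left B ha) h.symm)

lemma Conn.insert {S : Shape} (hS : Conn S) {a v : Cell} (ha : a ∈ S) (h : Near v a) :
    Conn (insert v S) := by
  rw [Finset.insert_eq]
  exact (conn_singleton v).union hS (Finset.mem_singleton_self v) ha h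

/-- A cell `p` may be removed from a connected shape if all its neighbours are near one of two
cells `b₁`, `b₂` of the shape that are linked through a third cell `s`.  It is applied to the
junction `p` of a T: two opposite neighbours `b₁`, `b₂` of `p` and a perpendicular one `s`. -/
lemma Conn.erase {S : Shape} (hS : Conn S) {p b₁ b₂ s : Cell}
    (h₁ : b₁ ∈ S.erase p) (h₂ : b₂ ∈ S.erase p) (hs : s ∈ S.erase p)
    (n₁ : Near b₁ s) (n₂ : Near b₂ s)
    (hn : ∀ w, w ≠ p → Near w p → Near w b₁ ∨ Near w b₂) : Conn (S.erase p) := by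
  refine conn_of_hub hs fun v hv => ?_
  have near_p : ∀ w ∈ S.erase p, Near w p → Linked (S.erase p) w s := by
    intro w hw hwp
    rcases hn w (Finset.ne_of_mem_erase hw) hwp with h | h
    · exact (Linked.of_near hw h₁ h).trans (Linked.of_near h₁ hs n₁)
    · exact (Linked.of_near hw h₂ h).trans (Linked.of_near h₂ hs n₂)
  -- follow a chain from `v` to `s` in `S`, up to its first visit of `p`
  have key : ∀ v, Linked S v s → v ∈ S.erase p → Linked (S.erase p) v s := by
    intro v hvs
    induction hvs using Relation.ReflTransGen.head_induction_on with
    | refl => intro _; exact .refl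
    | @head a b hab _ ih =>
      intro ha
      by_cases hb : b = p
      · exact near_p a ha (hb ▸ hab.2.2)
      · have hb' : b ∈ S.erase p := Finset.mem_erase.2 ⟨hb, hab.2.1⟩
        exact (Linked.of_near ha hb' hab.2.2).trans (ih hb')
  exact key v (hS.2 v (Finset.mem_of_mem_erase hv) s (Finset.mem_of_mem_erase hs)) hv

lemma Conn.isConnected {S : Shape} (hS : Conn S) : S.IsConnected := by
  have key : ∀ u v, Linked S u v → ∀ (hu : u ∈ S) (hv : v ∈ S),
      S.graph.Reachable ⟨u, hu⟩ ⟨v, hv⟩ := by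
    intro u v h
    induction h with
    | refl => intro _ _; exact .refl _
    | @tail b c _ hbc ih =>
      intro hu hv
      refine (ih hu hbc.1).trans ?_
      by_cases h : b = c
      · subst h; exact .refl _
      · exact SimpleGraph.Adj.reachable (show Cell.Neighbour b c from ⟨h, hbc.2.2⟩)
  have : Nonempty {u : Cell // u ∈ S} := let ⟨g, hg⟩ := hS.1; ⟨⟨g, hg⟩⟩
  exact ⟨fun u v => key _ _ (hS.2 u u.2 v v.2) u.2 v.2⟩

/-! ### Line moves as shifts of one cell -/

/-- Seen as a set, a line move vacates the cell `u` at one end of a line and fills the cell `v`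
beyond its other end; the cells strictly between are occupied. -/
def Shift (S : Shape) (u v : Cell) : Prop :=
  u ∈ S ∧ v ∉ S ∧
    ((u.2 = v.2 ∧ ∀ t, (u.1 < t ∧ t < v.1 ∨ v.1 < t ∧ t < u.1) → (t, u.2) ∈ S) ∨
      (u.1 = v.1 ∧ ∀ t, (u.2 < t ∧ t < v.2 ∨ v.2 < t ∧ t < u.2) → (u.1, t) ∈ S))

lemma mem_hLine {x y k a b : ℕ} : (a, b) ∈ hLine x y k ↔ b = y ∧ x ≤ a ∧ a < x + k := by
  simp only [hLine, Finset.mem_image, Finset.mem_range, Prod.mk.injEq]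
  constructor
  · rintro ⟨i, hi, rfl, rfl⟩; omega
  · rintro ⟨rfl, h₁, h₂⟩; exact ⟨a - x, by omega, by omega, rfl⟩

lemma mem_vLine {x y k a b : ℕ} : (a, b) ∈ vLine x y k ↔ a = x ∧ y ≤ b ∧ b < y + k := by
  simp only [vLine, Finset.mem_image, Finset.mem_range, Prod.mk.injEq]
  constructor
  · rintro ⟨i, hi, rfl, rfl⟩; omega
  · rintro ⟨rfl, h₁, h₂⟩; exact ⟨b - y, by omega, rfl, by omega⟩

lemma Shift.lineMove {S : Shape} {u v : Cell} (h : Shift S u v) :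
    LineMove S (insert v (S.erase u)) := by
  obtain ⟨x, y⟩ := u
  obtain ⟨x', y'⟩ := v
  obtain ⟨hu, hv, ⟨h, hb⟩ | ⟨h, hb⟩⟩ := h
  · obtain rfl : y = y' := h
    simp only at hb
    have hne : x ≠ x' := by rintro rfl; exact hv hu
    rcases lt_or_gt_of_ne hne with hlt | hlt
    · have hL : hLine x y (x' - x) ⊆ S := by
        rintro ⟨a, b⟩ hab
        obtain ⟨rfl, h₁, h₂⟩ := mem_hLine.1 hab
        rcases h₁.eq_or_lt with rfl | h₁
        exacts [hu, hb a (by omega)]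
      have := LineMove.right (S := S) x y (x' - x) (by omega) hL
        (by rwa [Nat.add_sub_cancel' hlt.le])
      convert this using 1
      ext ⟨a, b⟩
      have := @hL (a, b)
      simp only [Finset.mem_insert, Finset.mem_erase, Finset.mem_union, Finset.mem_sdiff,
        mem_hLine, Prod.mk.injEq, ne_eq] at this ⊢
      grind
    · have hL : hLine (x' + 1) y (x - x') ⊆ S := by
        rintro ⟨a, b⟩ hab
        obtain ⟨rfl, h₁, h₂⟩ := mem_hLine.1 hab
        by_cases h₃ : a = x
        · exact h₃ ▸ hu
        · exact hb a (by omega)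
      have := LineMove.left (S := S) x' y (x - x') (by omega) hL hv
      convert this using 1
      ext ⟨a, b⟩
      have := @hL (a, b)
      simp only [Finset.mem_insert, Finset.mem_erase, Finset.mem_union, Finset.mem_sdiff,
        mem_hLine, Prod.mk.injEq, ne_eq] at this ⊢
      grind
  · obtain rfl : x = x' := h
    simp only at hb
    have hne : y ≠ y' := by rintro rfl; exact hv hu
    rcases lt_or_gt_of_ne hne with hlt | hlt
    · have hL : vLine x y (y' - y) ⊆ S := by
        rintro ⟨a, b⟩ hab
        obtain ⟨rfl, h₁, h₂⟩ := mem_vLine.1 hab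
        rcases h₁.eq_or_lt with rfl | h₁
        exacts [hu, hb b (by omega)]
      have := LineMove.up (S := S) x y (y' - y) (by omega) hL
        (by rwa [Nat.add_sub_cancel' hlt.le])
      convert this using 1
      ext ⟨a, b⟩
      have := @hL (a, b)
      simp only [Finset.mem_insert, Finset.mem_erase, Finset.mem_union, Finset.mem_sdiff,
        mem_vLine, Prod.mk.injEq, ne_eq] at this ⊢
      grind
    · have hL : vLine x (y' + 1) (y - y') ⊆ S := by
        rintro ⟨a, b⟩ hab
        obtain ⟨rfl, h₁, h₂⟩ := mem_vLine.1 hab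
        by_cases h₃ : b = y
        · exact h₃ ▸ hu
        · exact hb b (by omega)
      have := LineMove.down (S := S) x y' (y - y') (by omega) hL hv
      convert this using 1
      ext ⟨a, b⟩
      have := @hL (a, b)
      simp only [Finset.mem_insert, Finset.mem_erase, Finset.mem_union, Finset.mem_sdiff,
        mem_vLine, Prod.mk.injEq, ne_eq] at this ⊢
      grind

lemma Shift.ne {S : Shape} {u v : Cell} (h : Shift S u v) : u ≠ v := by
  rintro rfl; exact h.2.1 h.1

lemma Shift.card {S : Shape} {u v : Cell} (h : Shift S u v) :
    (insert v (S.erase u)).card = S.card := by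
  rw [Finset.card_insert_of_notMem (fun h' => h.2.1 (Finset.mem_of_mem_erase h')),
    Finset.card_erase_add_one h.1]

lemma Shift.symm {S : Shape} {u v : Cell} (h : Shift S u v) :
    Shift (insert v (S.erase u)) v u ∧ insert u ((insert v (S.erase u)).erase v) = S := by
  have hne := h.ne
  obtain ⟨x, y⟩ := u
  obtain ⟨x', y'⟩ := v
  obtain ⟨hu, hv, hb⟩ := h
  refine ⟨⟨by simp, ?_, ?_⟩, ?_⟩
  · simp [hne]
  · simp only [Finset.mem_insert, Finset.mem_erase, ne_eq, Prod.mk.injEq] at hb ⊢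
    rcases hb with ⟨rfl, hb⟩ | ⟨rfl, hb⟩
    · exact .inl ⟨rfl, fun t ht => .inr ⟨by omega, hb t (by omega)⟩⟩
    · exact .inr ⟨rfl, fun t ht => .inr ⟨by omega, hb t (by omega)⟩⟩
  · rw [Finset.erase_insert (fun h' => hv (Finset.mem_of_mem_erase h')), Finset.insert_erase hu]

/-- `Reach m A B`: at most `m` line moves through connected shapes lead from `A` to `B`. -/
inductive Reach : ℕ → Shape → Shape → Prop
  | refl (m : ℕ) {A : Shape} (hA : Conn A) : Reach m A A
  | step {m : ℕ} {A B : Shape} {u v : Cell} (h : Reach m A B) (hs : Shift B u v)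
      (hc : Conn (insert v (B.erase u))) : Reach (m + 1) A (insert v (B.erase u))

lemma Reach.mono {m n : ℕ} (hmn : m ≤ n) {A B : Shape} (h : Reach m A B) : Reach n A B := by
  induction h generalizing n with
  | refl m hA => exact .refl n hA
  | step h hs hc ih =>
    obtain ⟨n, rfl⟩ : ∃ n', n = n' + 1 := ⟨n - 1, by omega⟩
    exact .step (ih (by omega)) hs hc

lemma Reach.trans {m n : ℕ} {A B C : Shape} (h : Reach m A B) (h' : Reach n B C) :
    Reach (m + n) A C := by
  induction h' with
  | refl n hA => exact h.mono (by omega)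
  | step h₂ hs hc ih => exact Reach.step (ih h) hs hc

lemma Reach.conn_right {m : ℕ} {A B : Shape} (h : Reach m A B) : Conn B := by
  cases h with
  | refl _ hA => exact hA
  | step _ _ hc => exact hc

lemma Reach.of_shift {A : Shape} {u v : Cell} (hA : Conn A) (hs : Shift A u v)
    (hc : Conn (insert v (A.erase u))) : Reach 1 A (insert v (A.erase u)) :=
  .step (.refl 0 hA) hs hc

lemma Reach.symm {m : ℕ} {A B : Shape} (h : Reach m A B) : Reach m B A := by
  induction h with
  | refl m hA => exact .refl m hA
  | @step m A B u v h hs hc ih =>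
    have := Reach.of_shift hc hs.symm.1 (by rw [hs.symm.2]; exact h.conn_right)
    rw [hs.symm.2] at this
    exact (this.trans ih).mono (by omega)

lemma Reach.card {m : ℕ} {A B : Shape} (h : Reach m A B) : B.card = A.card := by
  induction h with
  | refl => rfl
  | step _ hs _ ih => rw [hs.card, ih]

lemma Reach.connectedTransformation {m : ℕ} {A B : Shape} (h : Reach m A B) :
    ∃ k ≤ m, ConnectedTransformation k A B := by
  induction h with
  | @refl m A hA =>
    exact ⟨0, Nat.zero_le _, fun _ => A, rfl, rfl, fun _ h => by omega, fun _ _ => hA.isConnected⟩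
  | @step m A B u v h hs hc ih =>
    obtain ⟨k, hk, c, h0, h1, h2, h3⟩ := ih
    refine ⟨k + 1, by omega, fun i => if i ≤ k then c i else insert v (B.erase u), ?_, ?_, ?_, ?_⟩
    · simpa using h0
    · simp
    · intro i hi
      rcases Nat.lt_or_ge i k with hik | hik
      · simpa [hik.le, Nat.succ_le_of_lt hik] using h2 i hik
      · obtain rfl : i = k := by omega
        simpa [h1] using hs.lineMove
    · intro i hi
      by_cases hik : i ≤ k
      · simpa [hik] using h3 i hik
      · simpa [hik] using hc.isConnected

/-- Vacating `j` to fill `v`, and then `u` to fill `j`, amounts to vacating `u` and filling `v`. -/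
lemma Reach.flow {m : ℕ} {S : Shape} {u j v : Cell} (hu : u ∈ S) (hj : j ∈ S) (hv : v ∉ S)
    (h : Reach m S (insert v (S.erase j))) (hs : Shift (insert v (S.erase j)) u j)
    (hc : Conn (insert v (S.erase u))) : Reach (m + 1) S (insert v (S.erase u)) := by
  have huj := hs.ne
  have hvu : v ≠ u := by rintro rfl; exact hv hu
  have : insert j ((insert v (S.erase j)).erase u) = insert v (S.erase u) := by
    rw [Finset.erase_insert_of_ne hvu, Finset.erase_right_comm, Finset.insert_comm,
      Finset.insert_erase (Finset.mem_erase.2 ⟨huj.symm, hj⟩)]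
  rw [← this]
  exact .step h hs (this ▸ hc)

lemma shift_row {S : Shape} {x x' y : ℕ} (hu : (x, y) ∈ S) (hv : (x', y) ∉ S)
    (h : ∀ t, (x < t ∧ t < x' ∨ x' < t ∧ t < x) → (t, y) ∈ S) : Shift S (x, y) (x', y) :=
  ⟨hu, hv, .inl ⟨rfl, h⟩⟩

lemma shift_col {S : Shape} {x y y' : ℕ} (hu : (x, y) ∈ S) (hv : (x, y') ∉ S)
    (h : ∀ t, (y < t ∧ t < y' ∨ y' < t ∧ t < y) → (x, t) ∈ S) : Shift S (x, y) (x, y') :=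
  ⟨hu, hv, .inr ⟨rfl, h⟩⟩

/-! ### Rows and rays -/

/-- The cells `(t, y)` with `x ≤ t < z`. -/
def row (x z y : ℕ) : Shape := Finset.Ico x z ×ˢ {y}

lemma mem_row {x z y a b : ℕ} : (a, b) ∈ row x z y ↔ (x ≤ a ∧ a < z) ∧ b = y := by
  simp only [row, Finset.mem_product, Finset.mem_Ico, Finset.mem_singleton]

lemma row_succ {x z y : ℕ} (h : x ≤ z) : row x (z + 1) y = insert (z, y) (row x z y) := by
  ext ⟨a, b⟩
  simp only [mem_row, Finset.mem_insert, Prod.mk.injEq]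
  omega

lemma row_eq_empty {x z y : ℕ} (h : z ≤ x) : row x z y = ∅ := by
  simp [row, Finset.Ico_eq_empty_of_le h]

lemma conn_row {x z y : ℕ} (h : x < z) : Conn (row x z y) := by
  induction z, h using Nat.le_induction with
  | base =>
    have : row x x.succ y = {(x, y)} := by
      ext ⟨a, b⟩; simp only [mem_row, Finset.mem_singleton, Prod.mk.injEq]; omega
    rw [this]; exact conn_singleton _
  | succ z hz ih =>
    rw [row_succ (by omega)]
    exact ih.insert (a := (z - 1, y)) (mem_row.2 (by omega)) (by simp only [Near]; omega)

lemma Conn.union_row {E : Shape} (hE : Conn E) {c : Cell} (hc : c ∈ E) {x z y : ℕ}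
    (h : x < z → Near c (x, y)) : Conn (E ∪ row x z y) := by
  rcases Nat.lt_or_ge x z with hx | hx
  · exact hE.union (conn_row hx) hc (mem_row.2 (by omega)) (h hx)
  · rwa [row_eq_empty hx, Finset.union_empty]

/-- The first cell outside `S` of a row, from column `x` to the right. -/
lemma exists_tip (S : Shape) (x y : ℕ) :
    ∃ z, x ≤ z ∧ (z, y) ∉ S ∧ ∀ t, x ≤ t → t < z → (t, y) ∈ S := by
  have hex : ∃ z, x ≤ z ∧ (z, y) ∉ S := by
    by_contra! hcon
    refine Set.infinite_of_injective_forall_mem (f := fun i : ℕ => ((x + i, y) : Cell)) ?_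
      (fun i => hcon (x + i) (by omega)) S.finite_toSet
    intro i j hij
    simpa using hij
  classical
  refine ⟨Nat.find hex, (Nat.find_spec hex).1, (Nat.find_spec hex).2, fun t ht ht' => ?_⟩
  by_contra hcon
  exact Nat.find_min hex ht' ⟨ht, hcon⟩

/-- `S` consists of the environment `E` and of a line through `E`: the first cells, up to some
column, of the row of `c` from `c` to the right.  The line may run over cells of `E`, so that it
is the number of cells of `S` outside `E`, not the length of the row, that is preserved. -/
def Ray (E : Shape) (c : Cell) (S : Shape) : Prop := ∃ z, S = E ∪ row c.1 z c.2

lemma Ray.subset {E S : Shape} {c : Cell} (h : Ray E c S) : E ⊆ S := by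
  obtain ⟨z, rfl⟩ := h; exact Finset.subset_union_left

lemma Ray.conn {E S : Shape} {c : Cell} (h : Ray E c S) (hE : Conn E) (hc : c ∈ E) : Conn S := by
  obtain ⟨z, rfl⟩ := h; exact hE.union_row hc fun _ => Near.refl _

/-- The last cell of a ray outside the environment. -/
lemma Ray.last {E S : Shape} {c : Cell} (h : Ray E c S) (hcard : E.card < S.card) :
    ∃ z, c.1 ≤ z ∧ (z, c.2) ∉ E ∧ S = E ∪ row c.1 (z + 1) c.2 := by
  obtain ⟨z, rfl⟩ := h
  induction z with
  | zero => rw [row_eq_empty (Nat.zero_le _), Finset.union_empty] at hcard; omega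
  | succ z ih =>
    by_cases hz : c.1 ≤ z
    · by_cases hzE : (z, c.2) ∈ E
      · have : E ∪ row c.1 (z + 1) c.2 = E ∪ row c.1 z c.2 := by
          rw [row_succ hz, Finset.union_insert, Finset.insert_eq_of_mem]
          exact Finset.mem_union_left _ hzE
        rw [this] at hcard ⊢
        exact ih hcard
      · exact ⟨z, hz, hzE, rfl⟩
    · rw [row_eq_empty (by omega), Finset.union_empty] at hcard; omega

lemma Ray.subset_or {E S S' : Shape} {c : Cell} (h : Ray E c S) (h' : Ray E c S') :
    S ⊆ S' ∨ S' ⊆ S := by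
  obtain ⟨z, rfl⟩ := h
  obtain ⟨z', rfl⟩ := h'
  rcases le_total z z' with hz | hz
  · left; apply Finset.union_subset_union_right; rintro ⟨a, b⟩; simp only [mem_row]; omega
  · right; apply Finset.union_subset_union_right; rintro ⟨a, b⟩; simp only [mem_row]; omega

lemma Ray.subset_of_card_le {E S S' : Shape} {c : Cell} (h : Ray E c S) (h' : Ray E c S')
    (hc : S.card ≤ S'.card) : S ⊆ S' := by
  rcases h.subset_or h' with hs | hs
  · exact hs
  · exact (Finset.eq_of_subset_of_card_le hs hc).symm.subset

lemma Ray.unique {E S S' : Shape} {c : Cell} (h : Ray E c S) (h' : Ray E c S')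
    (hc : S.card = S'.card) : S = S' :=
  (h.subset_of_card_le h' hc.le).antisymm (h'.subset_of_card_le h hc.ge)

lemma Ray.exists_card {E : Shape} {c : Cell} {k : ℕ} (hk : E.card ≤ k) :
    ∃ S, Ray E c S ∧ S.card = k := by
  induction k, hk using Nat.le_induction with
  | base => exact ⟨E, ⟨0, by rw [row_eq_empty (Nat.zero_le _), Finset.union_empty]⟩, rfl⟩
  | succ k _ ih =>
    obtain ⟨S, ⟨z, hz⟩, hcard⟩ := ih
    obtain ⟨t, ht, htS, hlt⟩ := exists_tip S c.1 c.2
    refine ⟨insert (t, c.2) S, ⟨t + 1, ?_⟩, by rw [Finset.card_insert_of_notMem htS, hcard]⟩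
    ext ⟨a, b⟩
    have h1 := @hlt a
    subst hz
    simp only [Finset.mem_insert, Finset.mem_union, mem_row, Prod.mk.injEq, not_or] at h1 htS ⊢
    by_cases hab : (a, b) ∈ E
    · simp [hab]
    · by_cases hb : b = c.2
      · subst hb; grind
      · simp [hab, hb]

/-- A ray with `k` cells outside the environment covers at least the `k` cells that follow its
starting cell. -/
lemma Ray.mem {E S : Shape} {c : Cell} (h : Ray E c S) (hc : c ∈ E) {k t : ℕ}
    (hk : E.card + k ≤ S.card) (ht : c.1 ≤ t) (htk : t ≤ c.1 + k) : (t, c.2) ∈ S := by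
  obtain ⟨z, rfl⟩ := h
  by_contra hcon
  have hz : z ≤ t := by
    by_contra hz
    exact hcon (Finset.mem_union_right _ (mem_row.2 (by omega)))
  have hrow : E ∪ row c.1 z c.2 ⊆ E ∪ row (c.1 + 1) t c.2 := by
    rintro ⟨a, b⟩ hab
    simp only [Finset.mem_union, mem_row] at hab ⊢
    rcases hab with hab | hab
    · exact .inl hab
    · by_cases ha : a = c.1
      · left; rw [ha, hab.2]; exact hc
      · right
        have : a < t := lt_of_lt_of_le hab.1.2 hz
        omega
  have h1 := (Finset.card_le_card hrow).trans (Finset.card_union_le _ _)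
  have h2 : (row (c.1 + 1) t c.2).card = t - (c.1 + 1) := by simp [row]
  have h3 : t ≠ c.1 := by
    rintro rfl; exact hcon (Finset.mem_union_left _ hc)
  omega

/-- Enlarging the environment by a cell `v`, when the last cell of the ray can be moved to `v`. -/
lemma Ray.add_cell {E S : Shape} {c v : Cell} {m : ℕ} (h : Ray E c S) (hS : Conn S)
    (hcard : E.card < S.card)
    (hflow : ∀ z, c.1 ≤ z → (z, c.2) ∉ E → S = E ∪ row c.1 (z + 1) c.2 → v ∉ S →
      Reach m S (insert v (S.erase (z, c.2)))) :
    ∃ S', Ray (insert v E) c S' ∧ S'.card = S.card ∧ Reach m S S' := by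
  by_cases hv : v ∈ S
  · refine ⟨S, ?_, rfl, .refl m hS⟩
    obtain ⟨z, hz⟩ := h
    refine ⟨z, ?_⟩
    rw [Finset.insert_union, ← hz, Finset.insert_eq_of_mem hv]
  · obtain ⟨z, hz, hzE, hzS⟩ := h.last hcard
    have hr := hflow z hz hzE hzS hv
    refine ⟨_, ⟨z, ?_⟩, hr.card, hr⟩
    rw [Finset.insert_union]
    congr 1
    rw [hzS, row_succ hz, Finset.union_insert, Finset.erase_insert]
    simp [hzE, mem_row]

/-! ### Merging a line into an adjacent row -/

lemma mem_insert_erase {S : Shape} {u v w : Cell} (h : w = v ∨ (w ≠ u ∧ w ∈ S)) :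
    w ∈ insert v (S.erase u) := by simpa using h

/-- The junction of a T with horizontal bar may be vacated. -/
lemma conn_junction_row {S : Shape} {v : Cell} {x x' x'' y s : ℕ} (h : Conn (insert v S))
    (hx : x = x' + 1) (hx' : x'' = x + 1) (hv : v ≠ (x, y)) (h₁ : (x', y) = v ∨ (x', y) ∈ S)
    (h₂ : (x'', y) = v ∨ (x'', y) ∈ S) (hs : s = y + 1 ∨ y = s + 1)
    (h₃ : (x, s) = v ∨ (x, s) ∈ S) : Conn (insert v (S.erase (x, y))) := by
  rw [← Finset.erase_insert_of_ne hv]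
  refine h.erase (b₁ := (x', y)) (b₂ := (x'', y)) (s := (x, s))
    (Finset.mem_erase.2 ⟨by simp; omega, Finset.mem_insert.2 h₁⟩)
    (Finset.mem_erase.2 ⟨by simp; omega, Finset.mem_insert.2 h₂⟩)
    (Finset.mem_erase.2 ⟨by simp; omega, Finset.mem_insert.2 h₃⟩)
    (by simp only [Near]; omega) (by simp only [Near]; omega) ?_
  rintro ⟨a, b⟩ hab
  simp only [Near, ne_eq, Prod.mk.injEq] at hab ⊢
  omega

/-- The junction of a T with vertical bar may be vacated. -/
lemma conn_junction_col {S : Shape} {v : Cell} {x y y' y'' s : ℕ} (h : Conn (insert v S))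
    (hy : y = y' + 1) (hy' : y'' = y + 1) (hv : v ≠ (x, y)) (h₁ : (x, y') = v ∨ (x, y') ∈ S)
    (h₂ : (x, y'') = v ∨ (x, y'') ∈ S) (hs : s = x + 1 ∨ x = s + 1)
    (h₃ : (s, y) = v ∨ (s, y) ∈ S) : Conn (insert v (S.erase (x, y))) := by
  rw [← Finset.erase_insert_of_ne hv]
  refine h.erase (b₁ := (x, y')) (b₂ := (x, y'')) (s := (s, y))
    (Finset.mem_erase.2 ⟨by simp; omega, Finset.mem_insert.2 h₁⟩)
    (Finset.mem_erase.2 ⟨by simp; omega, Finset.mem_insert.2 h₂⟩)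
    (Finset.mem_erase.2 ⟨by simp; omega, Finset.mem_insert.2 h₃⟩)
    (by simp only [Near]; omega) (by simp only [Near]; omega) ?_
  rintro ⟨a, b⟩ hab
  simp only [Near, ne_eq, Prod.mk.injEq] at hab ⊢
  omega

/-- The last cell `(z, y)` of a line in a row adjacent to the row of `(x', y')` can be moved to the
first free cell `(z', y')` to the right of `(x', y')`.  The shape that occurs in between misses one
cell of `E` at most, and that cell is then the junction of a T. -/
lemma merge_unit {E S : Shape} {x' y' l y z z' : ℕ} (hE : Conn E) (hc : (x', y') ∈ E)
    (hy : y = y' + 1 ∨ y' = y + 1) (hl₁ : x' ≤ l + 1) (hl₂ : l ≤ x' + 1) (hlz : l ≤ z)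
    (hu : (z, y) ∉ E) (hv : (z', y') ∉ E) (hz' : ∀ t, x' ≤ t → t < z' → (t, y') ∈ E)
    (hxz : x' ≤ z') (h₁ : (l, y) ∉ E ∨ l ≠ z') (h₂ : x' + 1 ≤ z ∨ z' ≤ z)
    (hS : S = E ∪ row l (z + 1) y) : Reach 2 S (insert (z', y') (S.erase (z, y))) := by
  have hxz' : x' < z' := lt_of_le_of_ne hxz (by rintro rfl; exact hv hc)
  have hSmem : ∀ a b, (a, b) ∈ S ↔ (a, b) ∈ E ∨ ((l ≤ a ∧ a < z + 1) ∧ b = y) := by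
    intro a b; rw [hS, Finset.mem_union, mem_row]
  have hvS : (z', y') ∉ S := by rw [hSmem]; rintro (h | h); exacts [hv h, by omega]
  have huS : (z, y) ∈ S := by rw [hSmem]; right; omega
  have hSc : Conn S := hS ▸ hE.union_row hc fun _ => by simp only [Near]; omega
  have hpre : (z' - 1, y') ∈ E := hz' _ (by omega) (by omega)
  have hSu : S.erase (z, y) = E ∪ row l z y := by
    rw [hS, row_succ hlz, Finset.union_insert, Finset.erase_insert]
    simp [hu, mem_row]
  have hfin : Conn (insert (z', y') (S.erase (z, y))) := by
    rw [hSu]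
    exact (hE.union_row hc fun _ => by simp only [Near]; omega).insert
      (Finset.mem_union_left _ hpre) (by simp only [Near]; omega)
  have hins : Conn (insert (z', y') S) :=
    hSc.insert (a := (z' - 1, y')) ((hSmem _ _).2 (.inl hpre)) (by simp only [Near]; omega)
  rcases lt_trichotomy z' z with hlt | heq | hgt
  · have hjS : (z', y) ∈ S := by rw [hSmem]; right; omega
    have hne : (z', y') ≠ (z', y) := by simp; omega
    have hc₁ : Conn (insert (z', y') (S.erase (z', y))) := by
      by_cases hj : (z', y) ∈ E
      · have hl : l < z' := by
          rcases h₁ with h | h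
          · rcases (show l ≤ z' by omega).eq_or_lt with rfl | h'
            exacts [(h hj).elim, h']
          · omega
        exact conn_junction_row (x' := z' - 1) (x'' := z' + 1) (s := y') hins (by omega) rfl hne
          (.inr ((hSmem _ _).2 (.inr (by omega)))) (.inr ((hSmem _ _).2 (.inr (by omega))))
          (by omega) (.inl rfl)
      · have : insert (z', y') (S.erase (z', y)) =
            insert (z', y') (E ∪ row l z' y) ∪ row (z' + 1) (z + 1) y := by
          ext ⟨a, b⟩
          simp only [Finset.mem_erase, Finset.mem_insert, Finset.mem_union, hSmem, mem_row, ne_eq,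
            Prod.mk.injEq]
          by_cases hab : (a, b) ∈ E
          · have : ¬ (a = z' ∧ b = y) := by rintro ⟨rfl, rfl⟩; exact hj hab
            simp [hab, this]
          · simp only [hab, false_or]; omega
        rw [this]
        refine Conn.union_row (c := (z', y')) ?_ (by simp) fun _ => by simp only [Near]; omega
        exact (hE.union_row hc fun _ => by simp only [Near]; omega).insert
          (Finset.mem_union_left _ hpre) (by simp only [Near]; omega)
    refine Reach.flow huS hjS hvS (.of_shift hSc (shift_col hjS hvS fun t ht => ?_) hc₁)
      (shift_row (mem_insert_erase (.inr ⟨by simp; omega, huS⟩)) ?_ fun t ht => ?_) hfin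
    · omega
    · simp; omega
    · exact mem_insert_erase (.inr ⟨by simp; omega, (hSmem _ _).2 (.inr (by omega))⟩)
  · subst heq
    exact (Reach.of_shift hSc (shift_col huS hvS fun t ht => by omega) hfin).mono (by omega)
  · have hx : x' + 1 ≤ z := by omega
    have hj : (z, y') ∈ E := hz' _ (by omega) hgt
    have hjS : (z, y') ∈ S := (hSmem _ _).2 (.inl hj)
    have hne : (z', y') ≠ (z, y') := by simp; omega
    have hb : (z - 1, y') ∈ E := hz' _ (by omega) (by omega)
    have hb' : (z + 1, y') ∈ E ∨ z + 1 = z' := by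
      rcases (show z + 1 ≤ z' by omega).eq_or_lt with h | h
      exacts [.inr h, .inl (hz' _ (by omega) h)]
    have hc₁ : Conn (insert (z', y') (S.erase (z, y'))) :=
      conn_junction_row (x' := z - 1) (x'' := z + 1) (s := y) hins (by omega) rfl hne
        (.inr ((hSmem _ _).2 (.inl hb)))
        (hb'.symm.imp (fun h => by rw [h]) fun h => (hSmem _ _).2 (.inl h)) hy (.inr huS)
    refine Reach.flow huS hjS hvS (.of_shift hSc (shift_row hjS hvS fun t ht => ?_) hc₁)
      (shift_col (mem_insert_erase (.inr ⟨by simp; omega, huS⟩)) ?_ fun t ht => ?_) hfin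
    · exact (hSmem _ _).2 (.inl (hz' _ (by omega) (by omega)))
    · simp; omega
    · omega

lemma Ray.refl (E : Shape) (c : Cell) : Ray E c E :=
  ⟨0, by rw [row_eq_empty (Nat.zero_le _), Finset.union_empty]⟩

lemma Ray.eq_of_card_le {E S : Shape} {c : Cell} (h : Ray E c S) (hc : S.card ≤ E.card) : S = E :=
  (Finset.eq_of_subset_of_card_le h.subset hc).symm

/-- A ray may start one cell later if its starting cell belongs to the environment. -/
lemma ray_succ_iff {E S : Shape} {x y : ℕ} (h : (x, y) ∈ E) :
    Ray E (x + 1, y) S ↔ Ray E (x, y) S := by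
  have key : ∀ z, E ∪ row (x + 1) z y = E ∪ row x z y := by
    intro z
    ext ⟨a, b⟩
    simp only [Finset.mem_union, mem_row]
    constructor
    · rintro (h | h); exacts [.inl h, .inr (by omega)]
    · rintro (h' | h')
      · exact .inl h'
      · by_cases ha : a = x
        · left; rwa [ha, h'.2]
        · right; omega
  constructor
  · rintro ⟨z, rfl⟩; exact ⟨z, key z⟩
  · rintro ⟨z, rfl⟩; exact ⟨z, (key z).symm⟩

/-- Cells in the row of the ray that precede the end of the ray may be moved to the environment. -/
lemma Ray.of_insert {E S : Shape} {x y t : ℕ} (h : Ray (insert (t, y) E) (x, y) S) (ht : x ≤ t)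
    (hlt : ∀ i, x ≤ i → i < t → (i, y) ∈ E) : Ray E (x, y) S := by
  obtain ⟨z, rfl⟩ := h
  refine ⟨max z (t + 1), ?_⟩
  ext ⟨a, b⟩
  have := hlt a
  simp only [Finset.mem_union, Finset.mem_insert, mem_row, Prod.mk.injEq]
  by_cases hab : (a, b) ∈ E
  · simp [hab]
  · by_cases hb : b = y
    · subst hb
      simp only [hab, imp_false, or_false, false_or, and_true] at this ⊢
      omega
    · simp [hab, hb]

lemma Ray.insert_start {E S : Shape} {x y : ℕ} (h : Ray E (x, y) S) (hc : E.card < S.card) :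
    Ray (insert (x, y) E) (x, y) S := by
  obtain ⟨z, hz, hzE, rfl⟩ := h.last hc
  refine ⟨z + 1, ?_⟩
  rw [Finset.insert_union, Finset.insert_eq_of_mem]
  exact Finset.mem_union_right _ (mem_row.2 ⟨⟨le_rfl, Nat.lt_succ_of_le hz⟩, rfl⟩)

/-- Every ray over `G` with `k` cells in all that starts in `c` can be moved to start in `c'`, by
at most `m` line moves. -/
def Transport (m : ℕ) (G : Shape) (k : ℕ) (c c' : Cell) : Prop :=
  ∀ S, Ray G c S → S.card = k → ∃ S', Ray G c' S' ∧ S'.card = k ∧ Reach m S S'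

lemma Transport.trans {m n k : ℕ} {G : Shape} {c c' c'' : Cell} (h : Transport m G k c c')
    (h' : Transport n G k c' c'') : Transport (m + n) G k c c'' := by
  intro S hS hk
  obtain ⟨S', hS', hk', hr⟩ := h S hS hk
  obtain ⟨S'', hS'', hk'', hr'⟩ := h' S' hS' hk'
  exact ⟨S'', hS'', hk'', hr.trans hr'⟩

lemma Transport.mono {m n k : ℕ} {G : Shape} {c c' : Cell} (h : Transport m G k c c')
    (hmn : m ≤ n) : Transport n G k c c' := by
  intro S hS hk
  obtain ⟨S', hS', hk', hr⟩ := h S hS hk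
  exact ⟨S', hS', hk', hr.mono hmn⟩

lemma Transport.symm {m k : ℕ} {G : Shape} {c c' : Cell} (h : Transport m G k c c')
    (hk : G.card ≤ k) : Transport m G k c' c := by
  intro S hS hSk
  obtain ⟨T, hT, hTk⟩ := Ray.exists_card (E := G) (c := c) hk
  obtain ⟨S', hS', hk', hr⟩ := h T hT hTk
  obtain rfl := hS'.unique hS (hk'.trans hSk.symm)
  exact ⟨T, hT, hTk, hr.symm⟩

/-- The line may slide along its row as long as it remains attached to the environment. -/
lemma transport_slide {E : Shape} {k x y : ℕ} {c : Cell} (hE : Conn E) (hc : c ∈ E)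
    (h₁ : Near c (x, y)) (h₂ : Near c (x + 1, y)) : Transport 1 E k (x, y) (x + 1, y) := by
  intro S hS hk
  have hSc : Conn S := by
    obtain ⟨z, rfl⟩ := hS
    exact hE.union_row hc fun _ => h₁
  by_cases hxE : (x, y) ∈ E
  · exact ⟨S, (ray_succ_iff hxE).2 hS, hk, .refl 1 hSc⟩
  rcases Nat.lt_or_ge E.card S.card with hlt | hge
  swap
  · obtain rfl := hS.eq_of_card_le hge
    exact ⟨S, .refl _ _, hk, .refl 1 hSc⟩
  obtain ⟨z, hz, hzE, hzS⟩ := hS.last hlt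
  simp only at hz hzE hzS
  obtain ⟨t, ht, htS, hbet⟩ := exists_tip S x y
  have hmem : ∀ a b, (a, b) ∈ S ↔ (a, b) ∈ E ∨ ((x ≤ a ∧ a < z + 1) ∧ b = y) := by
    intro a b; rw [hzS, Finset.mem_union, mem_row]
  have hxS : (x, y) ∈ S := (hmem _ _).2 (.inr (by omega))
  have hzt : z < t := by
    by_contra h; exact htS ((hmem _ _).2 (.inr (by omega)))
  have heq : insert (t, y) (S.erase (x, y)) = E ∪ row (x + 1) (t + 1) y := by
    ext ⟨a, b⟩
    have := hbet a
    simp only [Finset.mem_insert, Finset.mem_erase, Finset.mem_union, hmem, mem_row,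
      Prod.mk.injEq, ne_eq] at this ⊢
    by_cases hab : (a, b) ∈ E
    · have : ¬ (a = x ∧ b = y) := by rintro ⟨rfl, rfl⟩; exact hxE hab
      simp [hab, this]
    · by_cases hb : b = y
      · subst hb; simp only [hab, false_or, and_true] at this ⊢; omega
      · simp [hab, hb]
  have hfin : Conn (insert (t, y) (S.erase (x, y))) := by
    rw [heq]; exact hE.union_row hc fun _ => h₂
  have hr := Reach.of_shift hSc (shift_row hxS htS fun i hi => hbet i (by omega) (by omega)) hfin
  exact ⟨_, ⟨t + 1, heq⟩, hr.card.trans hk, hr⟩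

lemma insert_erase_ray {E : Shape} {v : Cell} {l z y : ℕ} (hl : l ≤ z) (hu : (z, y) ∉ E) :
    insert v ((E ∪ row l (z + 1) y).erase (z, y)) = insert v E ∪ row l z y := by
  rw [Finset.insert_union, row_succ hl, Finset.union_insert, Finset.erase_insert]
  simp [hu, mem_row]

/-- A line in an adjacent row that starts to the right of `(x', y')`, in a cell outside the
environment, merges into the row of `(x', y')`. -/
lemma merge_left {E S : Shape} {x' y' y : ℕ} (hE : Conn E) (hc : (x', y') ∈ E)
    (hy : y = y' + 1 ∨ y' = y + 1) (hl : (x' + 1, y) ∉ E) (hS : Ray E (x' + 1, y) S) :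
    ∃ S', Ray E (x', y') S' ∧ S'.card = S.card ∧ Reach (2 * (S.card - E.card)) S S' := by
  induction hn : S.card - E.card generalizing E S with
  | zero =>
    obtain rfl := hS.eq_of_card_le (by omega)
    exact ⟨S, .refl _ _, rfl, .refl _ hE⟩
  | succ n ih =>
    obtain ⟨z, hz, hzE, hzS⟩ := hS.last (by omega)
    simp only at hz hzE hzS
    obtain ⟨z', hz', hz'E, hbet⟩ := exists_tip E x' y'
    have hr := merge_unit hE hc hy (by omega) le_rfl hz hzE hz'E hbet hz' (.inl hl) (.inl hz) hzS
    have heq := insert_erase_ray (v := (z', y')) hz hzE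
    rw [← hzS] at heq
    have hcard := hr.card
    have hE1 : (insert (z', y') E).card = E.card + 1 := Finset.card_insert_of_notMem hz'E
    have hz'1 : x' < z' := lt_of_le_of_ne hz' (by rintro rfl; exact hz'E hc)
    obtain ⟨S', hS', hk, hr'⟩ := ih (E := insert (z', y') E)
      (hE.insert (hbet (z' - 1) (by omega) (by omega)) (by simp only [Near]; omega))
      (Finset.mem_insert_of_mem hc) (by simp [hl]; omega) ⟨z, heq⟩ (by omega)
    exact ⟨S', hS'.of_insert hz' hbet, hk.trans hcard, (hr.trans hr').mono (by omega)⟩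

/-- A line that starts directly above or below `(x', y')` merges into the row of `(x', y')`, if
the cell to the right of `(x', y')` is occupied. -/
lemma merge_straight_aux {E S : Shape} {x' y' y : ℕ} (hE : Conn E) (hc : (x', y') ∈ E)
    (hc' : (x' + 1, y') ∈ E) (hy : y = y' + 1 ∨ y' = y + 1) (hS : Ray E (x', y) S) :
    ∃ S', Ray E (x', y') S' ∧ S'.card = S.card ∧ Reach (2 * (S.card - E.card) + 1) S S' := by
  induction hn : S.card - E.card generalizing E S with
  | zero =>
    obtain rfl := hS.eq_of_card_le (by omega)
    exact ⟨S, .refl _ _, rfl, .refl _ hE⟩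
  | succ n ih =>
    obtain ⟨z, hz, hzE, hzS⟩ := hS.last (by omega)
    simp only at hz hzE hzS
    obtain ⟨z', hz', hz'E, hbet⟩ := exists_tip E x' y'
    have hz'1 : x' ≠ z' := by rintro rfl; exact hz'E hc
    have hz'2 : x' + 1 ≠ z' := by rintro rfl; exact hz'E hc'
    rcases hz.eq_or_lt with rfl | hz1
    · -- the last cell outside `E` lies next to `(x', y')`: it has to be pushed aside first, so
      -- that the cell `(x', y')`, which may not be the junction of a T, stays in place
      obtain ⟨S₁, hS₁, hk₁, hr₁⟩ := transport_slide (k := S.card) (x := x') (y := y) hE hc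
        (by simp only [Near]; omega) (by simp only [Near]; omega) S hS rfl
      have hScard : S.card ≤ E.card + 1 := by
        rw [hzS]
        refine (Finset.card_union_le _ _).trans (by simp [row])
      obtain ⟨t, ht, htE, htS⟩ := hS₁.last (by omega)
      simp only at ht htE htS
      have hr := merge_unit hE hc hy (by omega) le_rfl ht htE hz'E hbet hz' (.inr (by omega))
        (.inl ht) htS
      have heq := insert_erase_ray (v := (z', y')) ht htE
      rw [← htS] at heq
      have hcard := hr.card
      have hS' : Ray (insert (z', y') E) (x' + 1, y) (insert (z', y') (S₁.erase (t, y))) :=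
        ⟨t, heq⟩
      have heq' := hS'.eq_of_card_le (by
        rw [hcard, Finset.card_insert_of_notMem hz'E]; omega)
      refine ⟨_, ?_, hcard.trans hk₁, (hr₁.trans hr).mono (by omega)⟩
      rw [heq']
      exact (Ray.refl _ _).of_insert hz' hbet
    have hr := merge_unit hE hc hy (by omega) (by omega) hz hzE hz'E hbet hz' (.inr hz'1)
      (.inl hz1) hzS
    have heq := insert_erase_ray (v := (z', y')) hz hzE
    rw [← hzS] at heq
    have hcard := hr.card
    have hE1 : (insert (z', y') E).card = E.card + 1 := Finset.card_insert_of_notMem hz'E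
    obtain ⟨S', hS', hk, hr'⟩ := ih (E := insert (z', y') E)
      (hE.insert (hbet (z' - 1) (by omega) (by omega)) (by simp only [Near]; omega))
      (Finset.mem_insert_of_mem hc) (Finset.mem_insert_of_mem hc') ⟨z, heq⟩ (by omega)
    exact ⟨S', hS'.of_insert hz' hbet, hk.trans hcard, (hr.trans hr').mono (by omega)⟩

/-- A line of at least two cells that starts directly above or below `(x', y')` merges into the
row of `(x', y')`. -/
lemma merge_straight {E S : Shape} {x' y' y : ℕ} (hE : Conn E) (hc : (x', y') ∈ E)
    (hy : y = y' + 1 ∨ y' = y + 1) (hS : Ray E (x', y) S) (hcard2 : E.card + 2 ≤ S.card) :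
    ∃ S', Ray E (x', y') S' ∧ S'.card = S.card ∧ Reach (2 * (S.card - E.card) + 1) S S' := by
  obtain ⟨z, hz, hzE, hzS⟩ := hS.last (by omega)
  simp only at hz hzE hzS
  obtain ⟨z', hz', hz'E, hbet⟩ := exists_tip E x' y'
  have hz'1 : x' ≠ z' := by rintro rfl; exact hz'E hc
  have hz1 : x' < z := by
    refine lt_of_le_of_ne hz ?_
    rintro rfl
    have : S.card ≤ E.card + 1 := by
      rw [hzS]; exact (Finset.card_union_le _ _).trans (by simp [row])
    omega
  have hr := merge_unit hE hc hy (by omega) (by omega) hz hzE hz'E hbet hz' (.inr hz'1)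
    (.inl hz1) hzS
  have heq := insert_erase_ray (v := (z', y')) hz hzE
  rw [← hzS] at heq
  have hcard := hr.card
  have hE1 : (insert (z', y') E).card = E.card + 1 := Finset.card_insert_of_notMem hz'E
  have hc' : (x' + 1, y') ∈ insert (z', y') E := by
    rcases (show x' + 1 ≤ z' by omega).eq_or_lt with h | h
    · rw [h]; exact Finset.mem_insert_self _ _
    · exact Finset.mem_insert_of_mem (hbet _ (by omega) h)
  obtain ⟨S', hS', hk, hr'⟩ := merge_straight_aux
      (hE.insert (hbet (z' - 1) (by omega) (by omega)) (by simp only [Near]; omega))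
      (Finset.mem_insert_of_mem hc) hc' hy ⟨z, heq⟩
  exact ⟨S', hS'.of_insert hz' hbet, hk.trans hcard, (hr.trans hr').mono (by omega)⟩

/-- Moving a line of at least two cells between near cells of the environment. -/
lemma transport_near {G : Shape} {k : ℕ} {c c' : Cell} (hG : Conn G) (hc : c ∈ G) (hc' : c' ∈ G)
    (h : Near c c') (hk : G.card + 2 ≤ k) : Transport (2 * (k - G.card) + 1) G k c c' := by
  have straight : ∀ {x y y' : ℕ}, (x, y') ∈ G → (y = y' + 1 ∨ y' = y + 1) →
      Transport (2 * (k - G.card) + 1) G k (x, y) (x, y') := by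
    intro x y y' h' hy S hS hSk
    obtain ⟨S', hS', hk', hr⟩ := merge_straight hG h' hy hS (by omega)
    exact ⟨S', hS', hk'.trans hSk, hSk ▸ hr⟩
  have same : ∀ {x y : ℕ}, (x, y) ∈ G → Transport 0 G k (x, y) (x + 1, y) :=
    fun h S hS hSk => ⟨S, (ray_succ_iff h).2 hS, hSk, .refl 0 (hS.conn hG h)⟩
  have right : ∀ {x y y' : ℕ}, (x, y) ∈ G → (x + 1, y') ∈ G →
      (y = y' ∨ y = y' + 1 ∨ y' = y + 1) →
      Transport (2 * (k - G.card) + 1) G k (x, y) (x + 1, y') := by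
    rintro x y y' h h' (rfl | hy)
    · exact (same h).mono (Nat.zero_le _)
    · exact ((same h).trans (straight h' hy)).mono (by omega)
  obtain ⟨x, y⟩ := c
  obtain ⟨x', y'⟩ := c'
  simp only [Near] at h
  obtain hx | rfl | rfl : x = x' + 1 ∨ x = x' ∨ x' = x + 1 := by omega
  · subst hx
    exact (right hc' hc (by omega)).symm (by omega)
  · by_cases hy : y = y'
    · subst hy
      exact fun S hS hSk => ⟨S, hS, hSk, .refl _ (hS.conn hG hc)⟩
    · exact straight hc' (by omega)
  · exact right hc hc' (by omega)

/-- A line of at least two cells that starts in a cell outside the environment, but near the cell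
`c'` of the environment, can be moved to start in `c'`. -/
lemma absorb_start {F S : Shape} {c c' : Cell} (hF : Conn F) (hc : c ∉ F) (hc' : c' ∈ F)
    (h : Near c c') (hS : Ray F c S) (hk : F.card + 2 ≤ S.card) :
    ∃ S', Ray F c' S' ∧ S'.card = S.card ∧ Reach (2 * (S.card - F.card) + 2) S S' := by
  obtain ⟨x, y⟩ := c
  obtain ⟨x', y'⟩ := c'
  have h' := h
  simp only [Near] at h'
  obtain rfl | rfl | rfl : x = x' + 1 ∨ x = x' ∨ x' = x + 1 := by omega
  · by_cases hy : y = y'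
    · subst hy
      refine ⟨S, (ray_succ_iff hc').1 hS, rfl, .refl _ ?_⟩
      obtain ⟨z, rfl⟩ := hS
      exact hF.union_row hc' fun _ => h.symm
    · obtain ⟨S', hS', hk', hr⟩ := merge_left hF hc' (by omega) hc hS
      exact ⟨S', hS', hk', hr.mono (by omega)⟩
  · obtain ⟨S', hS', hk', hr⟩ := merge_straight hF hc'
      (by have : y ≠ y' := by
            rintro rfl; exact hc hc'
          omega) hS hk
    exact ⟨S', hS', hk', hr.mono (by omega)⟩
  · obtain ⟨S₁, hS₁, hk₁, hr₁⟩ := transport_slide (k := S.card) hF hc' h.symm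
      (by simp only [Near]; omega) S hS rfl
    by_cases hy : y = y'
    · subst hy
      exact ⟨S₁, hS₁, hk₁, hr₁.mono (by omega)⟩
    · obtain ⟨S', hS', hk', hr⟩ := merge_straight hF hc' (by omega) hS₁ (by omega)
      exact ⟨S', hS', hk'.trans hk₁, (hr₁.trans hr).mono (by omega)⟩

/-! ### Bridges between two rows -/

/-- The cells `(x, t)` with `y ≤ t < z`. -/
def col (x y z : ℕ) : Shape := {x} ×ˢ Finset.Ico y z

lemma mem_col {x y z a b : ℕ} : (a, b) ∈ col x y z ↔ a = x ∧ y ≤ b ∧ b < z := by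
  simp only [col, Finset.mem_product, Finset.mem_Ico, Finset.mem_singleton]

lemma card_col (x y z : ℕ) : (col x y z).card = z - y := by simp [col]

lemma card_row (x z y : ℕ) : (row x z y).card = z - x := by simp [row]

lemma conn_col {x y z : ℕ} (h : y < z) : Conn (col x y z) := by
  induction z, h using Nat.le_induction with
  | base =>
    have : col x y y.succ = {(x, y)} := by
      ext ⟨a, b⟩; simp only [mem_col, Finset.mem_singleton, Prod.mk.injEq]; omega
    rw [this]; exact conn_singleton _
  | succ z hz ih =>
    have : col x y (z + 1) = insert (x, z) (col x y z) := by
      ext ⟨a, b⟩; simp only [mem_col, Finset.mem_insert, Prod.mk.injEq]; omega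
    rw [this]
    exact ih.insert (a := (x, z - 1)) (mem_col.2 (by omega)) (by simp only [Near]; omega)

/-- `E` contains the bar of a T in row `y`, with junction `(x + 1, y)`, and all cells of that row
from the start `(w, y)` of a ray to the bar; the last cell of the ray can then pass the junction. -/
def Bar (E : Shape) (w x y : ℕ) : Prop := w ≤ x ∧ ∀ t, w ≤ t → t ≤ x + 2 → (t, y) ∈ E

lemma Bar.mono {E E' : Shape} {w x y : ℕ} (h : Bar E w x y) (hE : E ⊆ E') : Bar E' w x y :=
  ⟨h.1, fun t h₁ h₂ => hE (h.2 t h₁ h₂)⟩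

/-- The end of the ray can be moved through the junction of a bar to the next free cell `v` of the
column of the junction. -/
lemma add_col_cell {E S : Shape} {w x y s : ℕ} (hE : Conn E) (hb : Bar E w x y)
    (hS : Ray E (w, y) S) (hcard : E.card < S.card) (hs : s ≠ y)
    (hbet : ∀ t, (y < t ∧ t < s ∨ s < t ∧ t < y) → (x + 1, t) ∈ E) :
    ∃ S', Ray (insert (x + 1, s) E) (w, y) S' ∧ S'.card = S.card ∧ Reach 2 S S' := by
  obtain ⟨hwx, hb⟩ := hb
  have hwE : (w, y) ∈ E := hb w le_rfl (by omega)
  have hSc := hS.conn hE hwE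
  have hES := hS.subset
  refine hS.add_cell hSc hcard fun z hz hzE hzS hv => ?_
  simp only at hz hzE hzS
  have hzx : x + 2 < z := by
    by_contra h; exact hzE (hb z hz (by omega))
  -- the cell of the column next to `v`, on the side of the junction
  obtain ⟨s', hs', hnear⟩ : ∃ s', (x + 1, s') ∈ E ∧ Near (x + 1, s) (x + 1, s') := by
    rcases lt_or_gt_of_ne hs with h | h
    · by_cases h' : s + 1 = y
      · exact ⟨y, hb _ (by omega) (by omega), by simp only [Near]; omega⟩
      · exact ⟨s + 1, hbet _ (by omega), by simp only [Near]; omega⟩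
    · by_cases h' : y + 1 = s
      · exact ⟨y, hb _ (by omega) (by omega), by simp only [Near]; omega⟩
      · exact ⟨s - 1, hbet _ (by omega), by simp only [Near]; omega⟩
  obtain ⟨r, hr, hrE⟩ : ∃ r, (r = y + 1 ∨ y = r + 1) ∧
      ((x + 1, r) = (x + 1, s) ∨ (x + 1, r) ∈ E) := by
    rcases lt_or_gt_of_ne hs with h | h
    · refine ⟨y - 1, by omega, ?_⟩
      by_cases h' : y - 1 = s
      exacts [.inl (by rw [h']), .inr (hbet _ (by omega))]
    · refine ⟨y + 1, by omega, ?_⟩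
      by_cases h' : y + 1 = s
      exacts [.inl (by rw [h']), .inr (hbet _ (by omega))]
  have hfin : Conn (insert (x + 1, s) (S.erase (z, y))) := by
    rw [hzS, insert_erase_ray hz hzE]
    exact (hE.insert hs' hnear).union_row (Finset.mem_insert_of_mem hwE) fun _ => .refl _
  have hc₁ : Conn (insert (x + 1, s) (S.erase (x + 1, y))) :=
    conn_junction_row (x' := x) (x'' := x + 2) (s := r) (hSc.insert (hES hs') hnear) rfl rfl
      (by simpa using hs) (.inr (hES (hb _ (by omega) (by omega))))
      (.inr (hES (hb _ (by omega) (by omega)))) hr (hrE.imp id fun h => hES h)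
  have hjS : (x + 1, y) ∈ S := hES (hb _ (by omega) (by omega))
  have hrow : ∀ t, w ≤ t → t ≤ z → (t, y) ∈ S := fun t h₁ h₂ => by
    rw [hzS]; exact Finset.mem_union_right _ (mem_row.2 (by omega))
  refine Reach.flow (hrow z hz le_rfl) hjS hv
    (.of_shift hSc (shift_col hjS hv fun t ht => hES (hbet t ht)) hc₁)
    (shift_row (mem_insert_erase (.inr ⟨by simp; omega, hrow z hz le_rfl⟩)) ?_ fun t ht => ?_) hfin
  · simpa using hs.symm
  · exact mem_insert_erase (.inr ⟨by simp; omega, hrow t (by omega) (by omega)⟩)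

/-- The end of the ray can be moved through the junction of a bar, along a full column and through
a second junction `(x + 1, r)`, to the next free cell `v` of row `r`. -/
lemma add_row_cell {E S : Shape} {w x y r a : ℕ} (hE : Conn E) (hb : Bar E w x y)
    (hS : Ray E (w, y) S) (hcard : E.card < S.card) (hr : r ≠ y)
    (hcol : ∀ t, (y < t ∧ t ≤ r ∨ r ≤ t ∧ t < y) → (x + 1, t) ∈ E)
    (hbet : ∀ t, (x + 1 < t ∧ t < a ∨ a < t ∧ t < x + 1) → (t, r) ∈ E)
    (hnear : ∃ g ∈ E, Near (a, r) g)
    (hjun : ∀ T, E ⊆ T → (a, r) ∉ T → Conn (insert (a, r) T) →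
      Conn (insert (a, r) (T.erase (x + 1, r)))) :
    ∃ S', Ray (insert (a, r) E) (w, y) S' ∧ S'.card = S.card ∧ Reach 3 S S' := by
  obtain ⟨hwx, hb⟩ := hb
  obtain ⟨g, hg, hnear⟩ := hnear
  have hwE : (w, y) ∈ E := hb w le_rfl (by omega)
  have hSc := hS.conn hE hwE
  have hES := hS.subset
  refine hS.add_cell hSc hcard fun z hz hzE hzS hv => ?_
  simp only at hz hzE hzS
  have hzx : x + 2 < z := by
    by_contra h; exact hzE (hb z hz (by omega))
  obtain ⟨s, hs, hsE⟩ : ∃ s, (s = y + 1 ∨ y = s + 1) ∧ (x + 1, s) ∈ E := by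
    rcases lt_or_gt_of_ne hr with h | h
    · exact ⟨y - 1, by omega, hcol _ (by omega)⟩
    · exact ⟨y + 1, by omega, hcol _ (by omega)⟩
  have hins : Conn (insert (a, r) S) := hSc.insert (hES hg) hnear
  have hfin : Conn (insert (a, r) (S.erase (z, y))) := by
    rw [hzS, insert_erase_ray hz hzE]
    exact (hE.insert hg hnear).union_row (Finset.mem_insert_of_mem hwE) fun _ => .refl _
  have hj₁S : (x + 1, y) ∈ S := hES (hb _ (by omega) (by omega))
  have hj₂S : (x + 1, r) ∈ S := hES (hcol _ (by omega))
  have hc₁ : Conn (insert (a, r) (S.erase (x + 1, y))) :=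
    conn_junction_row (x' := x) (x'' := x + 2) (s := s) hins rfl rfl
      (by rintro h; exact hv (h ▸ hj₁S)) (.inr (hES (hb _ (by omega) (by omega))))
      (.inr (hES (hb _ (by omega) (by omega)))) hs (.inr (hES hsE))
  have hc₂ := hjun S hES hv hins
  have hrow : ∀ t, w ≤ t → t ≤ z → (t, y) ∈ S := fun t h₁ h₂ => by
    rw [hzS]; exact Finset.mem_union_right _ (mem_row.2 (by omega))
  have h₁ : Reach 1 S (insert (a, r) (S.erase (x + 1, r))) :=
    .of_shift hSc (shift_row hj₂S hv fun t ht => hES (hbet t ht)) hc₂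
  have ha : a ≠ x + 1 := by rintro rfl; exact hv hj₂S
  have h₂ : Reach 2 S (insert (a, r) (S.erase (x + 1, y))) := by
    refine Reach.flow hj₁S hj₂S hv h₁ (shift_col
      (mem_insert_erase (.inr ⟨by simpa using hr.symm, hj₁S⟩)) ?_ fun t ht => ?_) hc₁
    · simpa using ha.symm
    · exact mem_insert_erase (.inr ⟨by simp; omega, hES (hcol t (by omega))⟩)
  refine Reach.flow (hrow z hz le_rfl) hj₁S hv h₂
    (shift_row (mem_insert_erase (.inr ⟨by simp; omega, hrow z hz le_rfl⟩)) ?_ fun t ht => ?_) hfin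
  · simpa using fun _ h => hr h.symm
  · exact mem_insert_erase (.inr ⟨by simp; omega, hrow t (by omega) (by omega)⟩)

lemma add_col_up {E S : Shape} {w x y : ℕ} (hE : Conn E) (hb : Bar E w x y)
    (hS : Ray E (w, y) S) (i : ℕ) (hcard : E.card + i ≤ S.card) :
    ∃ S', Ray (E ∪ col (x + 1) (y + 1) (y + 1 + i)) (w, y) S' ∧ S'.card = S.card ∧
      Reach (2 * i) S S' := by
  have hj : (x + 1, y) ∈ E := hb.2 _ (by have := hb.1; omega) (by omega)
  induction i with
  | zero =>
    refine ⟨S, ?_, rfl, .refl _ (hS.conn hE (hb.2 _ le_rfl (by have := hb.1; omega)))⟩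
    rwa [Finset.union_eq_left.2]
    rintro ⟨a, b⟩ hab; rw [mem_col] at hab; omega
  | succ i ih =>
    obtain ⟨S₁, hS₁, hk₁, hr₁⟩ := ih (by omega)
    have hsub : E ⊆ E ∪ col (x + 1) (y + 1) (y + 1 + i) := Finset.subset_union_left
    have hconn : Conn (E ∪ col (x + 1) (y + 1) (y + 1 + i)) := by
      rcases Nat.eq_zero_or_pos i with rfl | hi
      · rwa [Finset.union_eq_left.2]
        rintro ⟨a, b⟩ hab; rw [mem_col] at hab; omega
      · exact hE.union (conn_col (by omega)) hj (mem_col.2 ⟨rfl, le_rfl, by omega⟩)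
          (by simp only [Near]; omega)
    have hle := Finset.card_union_le E (col (x + 1) (y + 1) (y + 1 + i))
    rw [card_col] at hle
    obtain ⟨S₂, hS₂, hk₂, hr₂⟩ := add_col_cell (s := y + 1 + i) hconn (hb.mono hsub) hS₁
      (by omega) (by omega)
      (fun t ht => Finset.mem_union_right _ (mem_col.2 (by omega)))
    refine ⟨S₂, ?_, hk₂.trans hk₁, hr₁.trans hr₂⟩
    convert hS₂ using 1
    ext ⟨a, b⟩
    simp only [Finset.mem_union, Finset.mem_insert, mem_col, Prod.mk.injEq]
    grind

lemma add_col_down {E S : Shape} {w x y : ℕ} (hE : Conn E) (hb : Bar E w x y)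
    (hS : Ray E (w, y) S) (i : ℕ) (hi : i ≤ y) (hcard : E.card + i ≤ S.card) :
    ∃ S', Ray (E ∪ col (x + 1) (y - i) y) (w, y) S' ∧ S'.card = S.card ∧
      Reach (2 * i) S S' := by
  have hj : (x + 1, y) ∈ E := hb.2 _ (by have := hb.1; omega) (by omega)
  induction i with
  | zero =>
    refine ⟨S, ?_, rfl, .refl _ (hS.conn hE (hb.2 _ le_rfl (by have := hb.1; omega)))⟩
    rwa [Finset.union_eq_left.2]
    rintro ⟨a, b⟩ hab; rw [mem_col] at hab; omega
  | succ i ih =>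
    obtain ⟨S₁, hS₁, hk₁, hr₁⟩ := ih (by omega) (by omega)
    have hsub : E ⊆ E ∪ col (x + 1) (y - i) y := Finset.subset_union_left
    have hconn : Conn (E ∪ col (x + 1) (y - i) y) := by
      rcases Nat.eq_zero_or_pos i with rfl | hi
      · rwa [Finset.union_eq_left.2]
        rintro ⟨a, b⟩ hab; rw [mem_col] at hab; omega
      · exact hE.union (b := (x + 1, y - 1)) (conn_col (by omega)) hj
          (mem_col.2 ⟨rfl, by omega, by omega⟩)
          (by simp only [Near]; omega)
    have hle := Finset.card_union_le E (col (x + 1) (y - i) y)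
    rw [card_col] at hle
    obtain ⟨S₂, hS₂, hk₂, hr₂⟩ := add_col_cell (s := y - (i + 1)) hconn (hb.mono hsub) hS₁
      (by omega) (by omega)
      (fun t ht => Finset.mem_union_right _ (mem_col.2 (by omega)))
    refine ⟨S₂, ?_, hk₂.trans hk₁, hr₁.trans hr₂⟩
    convert hS₂ using 1
    ext ⟨a, b⟩
    simp only [Finset.mem_union, Finset.mem_insert, mem_col, Prod.mk.injEq]
    grind

/-- Once a column with a vertical bar at row `r` is there, row `r` is filled from the junction to
the left. -/
lemma add_row_left {E S : Shape} {w x y r : ℕ} (hE : Conn E) (hb : Bar E w x y)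
    (hS : Ray E (w, y) S) (hyr : y < r) (hcol : ∀ t, y ≤ t → t ≤ r + 1 → (x + 1, t) ∈ E)
    (i : ℕ) (hi : i ≤ x + 1) (hcard : E.card + i ≤ S.card) :
    ∃ S', Ray (E ∪ row (x + 1 - i) (x + 1) r) (w, y) S' ∧ S'.card = S.card ∧
      Reach (3 * i) S S' := by
  induction i with
  | zero =>
    refine ⟨S, ?_, rfl, .refl _ (hS.conn hE (hb.2 _ le_rfl (by have := hb.1; omega)))⟩
    rwa [row_eq_empty (by omega), Finset.union_empty]
  | succ i ih =>
    obtain ⟨S₁, hS₁, hk₁, hr₁⟩ := ih (by omega) (by omega)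
    have hsub : E ⊆ E ∪ row (x + 1 - i) (x + 1) r := Finset.subset_union_left
    have hconn : Conn (E ∪ row (x + 1 - i) (x + 1) r) := by
      rcases Nat.eq_zero_or_pos i with rfl | hi
      · rwa [row_eq_empty (by omega), Finset.union_empty]
      · exact hE.union (b := (x, r)) (conn_row (by omega)) (hcol r (by omega) (by omega))
          (mem_row.2 (by omega)) (by simp only [Near]; omega)
    have hle := Finset.card_union_le E (row (x + 1 - i) (x + 1) r)
    rw [card_row] at hle
    have hprev : (x + 1 - i, r) ∈ E ∪ row (x + 1 - i) (x + 1) r := by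
      rcases Nat.eq_zero_or_pos i with rfl | hi
      · exact Finset.mem_union_left _ (hcol r (by omega) (by omega))
      · exact Finset.mem_union_right _ (mem_row.2 (by omega))
    obtain ⟨S₂, hS₂, hk₂, hr₂⟩ := add_row_cell (r := r) (a := x - i) hconn (hb.mono hsub) hS₁
      (by omega) (by omega) (fun t ht => hsub (hcol t (by omega) (by omega)))
      (fun t ht => Finset.mem_union_right _ (mem_row.2 (by omega)))
      ⟨_, hprev, by simp only [Near]; omega⟩
      (fun T hT hv hc => conn_junction_col (y' := r - 1) (y'' := r + 1) (s := x) hc (by omega) rfl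
        (by simp; omega) (.inr (hT (hsub (hcol _ (by omega) (by omega)))))
        (.inr (hT (hsub (hcol _ (by omega) (by omega))))) (by omega) (by
          rcases Nat.eq_zero_or_pos i with rfl | hi
          · exact .inl rfl
          · exact .inr (hT (Finset.mem_union_right _ (mem_row.2 (by omega))))))
    refine ⟨S₂, ?_, hk₂.trans hk₁, hr₁.trans hr₂⟩
    convert hS₂ using 1
    ext ⟨a, b⟩
    simp only [Finset.mem_union, Finset.mem_insert, mem_row, Prod.mk.injEq]
    grind

/-- Once a column with a vertical bar at row `r` is there, the rest of the ray is moved to row `r`,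
to the right of the junction. -/
lemma add_row_right {E S : Shape} {w x y r l : ℕ} (hE : Conn E) (hb : Bar E w x y)
    (hS : Ray E (w, y) S) (hyr : y < r) (hcol : ∀ t, y ≤ t → t ≤ r + 1 → (x + 1, t) ∈ E)
    (hl : ∀ t, l ≤ t → t ≤ x + 1 → (t, r) ∈ E) (hlx : l ≤ x + 1) :
    ∃ S', Ray E (l, r) S' ∧ S'.card = S.card ∧ Reach (3 * (S.card - E.card)) S S' := by
  induction hn : S.card - E.card generalizing E S with
  | zero =>
    obtain rfl := hS.eq_of_card_le (by omega)
    exact ⟨S, .refl _ _, rfl, .refl _ hE⟩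
  | succ n ih =>
    obtain ⟨z', hz', hz'E, hbet⟩ := exists_tip E l r
    have hz'1 : x + 1 < z' := by
      by_contra h; exact hz'E (hl _ hz' (by omega))
    have hE1 : (insert (z', r) E).card = E.card + 1 := Finset.card_insert_of_notMem hz'E
    have hprev : (z' - 1, r) ∈ E := hbet _ (by omega) (by omega)
    have hnear : Near (z', r) (z' - 1, r) := by simp only [Near]; omega
    obtain ⟨S₁, hS₁, hk₁, hr₁⟩ := add_row_cell (r := r) (a := z') hE hb hS
      (by omega) (by omega) (fun t ht => hcol t (by omega) (by omega))
      (fun t ht => hbet t (by omega) (by omega)) ⟨_, hprev, hnear⟩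
      (fun T hT hv hc => conn_junction_col (y' := r - 1) (y'' := r + 1) (s := x + 2) hc (by omega)
        rfl (by simp; omega) (.inr (hT (hcol _ (by omega) (by omega))))
        (.inr (hT (hcol _ (by omega) (by omega)))) (by omega) (by
          rcases (show x + 2 ≤ z' by omega).eq_or_lt with h | h
          · exact .inl (by rw [h])
          · exact .inr (hT (hbet _ (by omega) h))))
    have hsub := Finset.subset_insert (z', r) E
    obtain ⟨S₂, hS₂, hk₂, hr₂⟩ := ih (hE.insert hprev hnear) (hb.mono hsub) hS₁
      (fun t h₁ h₂ => hsub (hcol t h₁ h₂)) (fun t h₁ h₂ => hsub (hl t h₁ h₂)) (by omega)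
    exact ⟨S₂, hS₂.of_insert hz' hbet, hk₂.trans hk₁, (hr₁.trans hr₂).mono (by omega)⟩

/-- Cells of `S` may be declared part of the environment. -/
lemma Ray.absorb {E A S : Shape} {c : Cell} (h : Ray E c S) (hA : A ⊆ S) : Ray (E ∪ A) c S := by
  obtain ⟨z, rfl⟩ := h
  exact ⟨z, by rw [Finset.union_right_comm, Finset.union_eq_left.2 hA]⟩

/-- The line slides to the left, and its first `i` cells are added to the environment. -/
lemma add_row_start {E S : Shape} {x y : ℕ} (hE : Conn E) (hc : (x, y) ∈ E) (hS : Ray E (x, y) S)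
    (i : ℕ) (hi : i ≤ x) (hcard : E.card + i ≤ S.card) :
    ∃ S', Ray (E ∪ row (x - i) x y) (x - i, y) S' ∧ S'.card = S.card ∧ Reach i S S' := by
  induction i with
  | zero =>
    exact ⟨S, by rwa [Nat.sub_zero, row_eq_empty le_rfl, Finset.union_empty], rfl,
      .refl _ (hS.conn hE hc)⟩
  | succ i ih =>
    obtain ⟨S₁, hS₁, hk₁, hr₁⟩ := ih (by omega) (by omega)
    have hconn : Conn (E ∪ row (x - i) x y) := by
      rcases Nat.eq_zero_or_pos i with rfl | hi
      · rwa [Nat.sub_zero, row_eq_empty le_rfl, Finset.union_empty]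
      · exact hE.union (b := (x - 1, y)) (conn_row (by omega)) hc
          (mem_row.2 (by omega)) (by simp only [Near]; omega)
    have hstart : (x - i, y) ∈ E ∪ row (x - i) x y := by
      rcases Nat.eq_zero_or_pos i with rfl | hi
      · exact Finset.mem_union_left _ hc
      · exact Finset.mem_union_right _ (mem_row.2 (by omega))
    have hle := Finset.card_union_le E (row (x - i) x y)
    rw [card_row] at hle
    have hxi : x - i = x - (i + 1) + 1 := by omega
    obtain ⟨S₂, hS₂, hk₂, hr₂⟩ := (transport_slide (k := S.card) (x := x - (i + 1)) (y := y) hconn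
      hstart (by simp only [Near]; omega) (by simp only [Near]; omega)).symm (by omega) S₁
      (hxi ▸ hS₁) hk₁
    refine ⟨S₂, ?_, hk₂, hr₁.trans hr₂⟩
    convert hS₂.insert_start (by omega) using 1
    ext ⟨a, b⟩
    simp only [Finset.mem_union, Finset.mem_insert, mem_row, Prod.mk.injEq]
    grind

/-- The line moves to a higher row, at distance at most `l` in both directions, by means of a
bridge: a column that rises from the line just to the right of its start, and a piece of row `y'`
that joins this column to `(x', y')`.  Building the bridge from the lower line, and passing all of
the line over it, leads to the same shape as building it from the upper line. -/
lemma transport_up {G : Shape} {k l x y x' y' : ℕ} (hG : Conn G) (hc : (x, y) ∈ G)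
    (hc' : (x', y') ∈ G) (hy : y < y') (h₁ : x ≤ x' + l) (h₂ : x' ≤ x + l) (h₃ : y' ≤ y + l)
    (hk : G.card + 2 * l + 8 ≤ k) :
    Transport (7 * (k - G.card)) G k (x, y) (x', y') := by
  intro S hS hSk
  obtain ⟨w, hwx, hwx', hw⟩ : ∃ w, w ≤ x ∧ w ≤ x' ∧ (w = x ∨ w = x') :=
    ⟨min x x', by omega, by omega, by omega⟩
  -- the bridge, built from below
  have hA : row x (x + 3) y ⊆ S := by
    rintro ⟨a, b⟩ hab
    rw [mem_row] at hab
    obtain rfl : b = y := hab.2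
    exact hS.mem (k := 2) hc (by omega) hab.1.1 (by simp only; omega)
  have hS₁ := hS.absorb hA
  have hE₁ : Conn (G ∪ row x (x + 3) y) := hG.union_row hc fun _ => .refl _
  have hb₁ : Bar (G ∪ row x (x + 3) y) x x y :=
    ⟨le_rfl, fun t _ _ => Finset.mem_union_right _ (mem_row.2 (by omega))⟩
  have hcard₁ := Finset.card_union_le G (row x (x + 3) y)
  rw [card_row] at hcard₁
  obtain ⟨S₂, hS₂, hk₂, hr₂⟩ := add_col_up hE₁ hb₁ hS₁ (y' - y + 1) (by omega)
  have hy₂ : y + 1 + (y' - y + 1) = y' + 2 := by omega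
  rw [hy₂] at hS₂
  have hE₂ : Conn (G ∪ row x (x + 3) y ∪ col (x + 1) (y + 1) (y' + 2)) :=
    hE₁.union (a := (x + 1, y)) (b := (x + 1, y + 1)) (conn_col (by omega))
      (hb₁.2 _ (by omega) (by omega)) (mem_col.2 (by omega)) (by simp only [Near]; omega)
  have hb₂ := hb₁.mono (E' := G ∪ row x (x + 3) y ∪ col (x + 1) (y + 1) (y' + 2))
    Finset.subset_union_left
  have hcard₂ := Finset.card_union_le (G ∪ row x (x + 3) y) (col (x + 1) (y + 1) (y' + 2))
  rw [card_col] at hcard₂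
  have hcol₂ : ∀ t, y ≤ t → t ≤ y' + 1 →
      (x + 1, t) ∈ G ∪ row x (x + 3) y ∪ col (x + 1) (y + 1) (y' + 2) := by
    intro t h h'
    rcases h.eq_or_lt with rfl | h
    · exact hb₂.2 _ (by omega) (by omega)
    · exact Finset.mem_union_right _ (mem_col.2 (by omega))
  obtain ⟨S₃, hS₃, hk₃, hr₃⟩ := add_row_left hE₂ hb₂ hS₂ hy hcol₂ (x + 1 - w) (by omega) (by omega)
  have hw₃ : x + 1 - (x + 1 - w) = w := by omega
  rw [hw₃] at hS₃
  set E := G ∪ row x (x + 3) y ∪ col (x + 1) (y + 1) (y' + 2) ∪ row w (x + 1) y' with hEdef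
  have hsub : G ∪ row x (x + 3) y ∪ col (x + 1) (y + 1) (y' + 2) ⊆ E := Finset.subset_union_left
  have hE : Conn E := hE₂.union (a := (x + 1, y')) (b := (x, y')) (conn_row (by omega))
    (hcol₂ _ (by omega) (by omega)) (mem_row.2 (by omega)) (by simp only [Near]; omega)
  obtain ⟨S₄, hS₄, hk₄, hr₄⟩ := add_row_right (l := w) hE (hb₂.mono hsub) hS₃ hy
    (fun t h h' => hsub (hcol₂ t h h')) (fun t h h' => by
      rcases h'.eq_or_lt with rfl | h'
      · exact hsub (hcol₂ _ (by omega) (by omega))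
      · exact Finset.mem_union_right _ (mem_row.2 (by omega))) (by omega)
  have hcardE : G.card ≤ E.card :=
    Finset.card_le_card (fun a ha => hsub (Finset.mem_union_left _ (Finset.mem_union_left _ ha)))
  -- the bridge, built from above
  obtain ⟨T, hT, hTk⟩ := Ray.exists_card (E := G) (c := (x', y')) (k := k) (by omega)
  obtain ⟨T₁, hT₁, hl₁, hq₁⟩ := add_row_start hG hc' hT (x' - w) (by omega) (by omega)
  have hw₁ : x' - (x' - w) = w := by omega
  rw [hw₁] at hT₁
  have hD₁ : Conn (G ∪ row w x' y') := by
    rcases hwx'.eq_or_lt with rfl | h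
    · rwa [row_eq_empty le_rfl, Finset.union_empty]
    · exact hG.union (b := (x' - 1, y')) (conn_row h) hc' (mem_row.2 (by omega))
        (by simp only [Near]; omega)
  have hwD₁ : (w, y') ∈ G ∪ row w x' y' := by
    rcases hwx'.eq_or_lt with rfl | h
    · exact Finset.mem_union_left _ hc'
    · exact Finset.mem_union_right _ (mem_row.2 (by omega))
  have hd₁ := Finset.card_union_le G (row w x' y')
  rw [card_row] at hd₁
  have hB : row w (x + 3) y' ⊆ T₁ := by
    rintro ⟨a, b⟩ hab
    rw [mem_row] at hab
    obtain rfl : b = y' := hab.2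
    exact hT₁.mem (k := l + 2) hwD₁ (by omega) hab.1.1 (by simp only; omega)
  have hT₂ := hT₁.absorb hB
  have hD₂ : Conn (G ∪ row w x' y' ∪ row w (x + 3) y') := hD₁.union_row hwD₁ fun _ => .refl _
  have hbar₂ : Bar (G ∪ row w x' y' ∪ row w (x + 3) y') w x y' :=
    ⟨hwx, fun t _ _ => Finset.mem_union_right _ (mem_row.2 (by omega))⟩
  have hd₂ : (G ∪ row w x' y' ∪ row w (x + 3) y').card ≤ G.card + (l + 3) := by
    have : G ∪ row w x' y' ∪ row w (x + 3) y' ⊆ G ∪ row w (w + l + 3) y' := by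
      rintro ⟨a, b⟩; simp only [Finset.mem_union, mem_row]; grind
    refine (Finset.card_le_card this).trans ((Finset.card_union_le _ _).trans ?_)
    rw [card_row]; omega
  obtain ⟨T₃, hT₃, hl₃, hq₃⟩ := add_col_down hD₂ hbar₂ hT₂ (y' - y) (by omega) (by omega)
  have hy₃ : y' - (y' - y) = y := by omega
  rw [hy₃] at hT₃
  have hd₃ := Finset.card_union_le (G ∪ row w x' y' ∪ row w (x + 3) y') (col (x + 1) y y')
  rw [card_col] at hd₃
  set D₃ := G ∪ row w x' y' ∪ row w (x + 3) y' ∪ col (x + 1) y y' with hD₃def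
  have hsub₃ : G ∪ row w x' y' ∪ row w (x + 3) y' ⊆ D₃ := Finset.subset_union_left
  have hD₃ : Conn D₃ := hD₂.union (a := (x + 1, y')) (b := (x + 1, y' - 1)) (conn_col hy)
    (hbar₂.2 _ (by omega) (by omega)) (mem_col.2 (by omega)) (by simp only [Near]; omega)
  obtain ⟨T₄, hT₄, hl₄, hq₄⟩ := add_col_cell (s := y' + 1) hD₃ (hbar₂.mono hsub₃) hT₃ (by omega)
    (by omega) (fun t ht => by omega)
  have hd₄ := Finset.card_insert_le (x + 1, y' + 1) D₃
  have hcol₄ : ∀ t, y ≤ t → t ≤ y' → (x + 1, t) ∈ D₃ := by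
    intro t h h'
    rcases h'.eq_or_lt with rfl | h'
    · exact hsub₃ (hbar₂.2 _ (by omega) (by omega))
    · exact Finset.mem_union_right _ (mem_col.2 (by omega))
  have hsub₄ : D₃ ⊆ insert (x + 1, y' + 1) D₃ := Finset.subset_insert _ _
  have hcD₄ : (x, y) ∈ insert (x + 1, y' + 1) D₃ :=
    hsub₄ (hsub₃ (Finset.mem_union_left _ (Finset.mem_union_left _ hc)))
  obtain ⟨T₅, hT₅, hl₅, hq₅⟩ := add_row_cell (r := y) (a := x + 2)
    (hD₃.insert (hcol₄ y' hy.le le_rfl) (by simp only [Near]; omega))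
    (hbar₂.mono (hsub₃.trans hsub₄)) hT₄ (by omega) (by omega)
    (fun t ht => hsub₄ (hcol₄ t (by omega) (by omega))) (fun t ht => by omega)
    ⟨_, hsub₄ (hcol₄ y le_rfl hy.le), by simp only [Near]; omega⟩
    (fun T hT hv hc => conn_junction_row (x' := x) (x'' := x + 2) (s := y + 1) hc rfl rfl
      (by simp) (.inr (hT hcD₄)) (.inl rfl) (.inl rfl)
      (.inr (hT (hsub₄ (hcol₄ _ (by omega) (by omega))))))
  -- both constructions end in the same shape
  have hfin : Ray E (w, y') T₅ := by
    obtain ⟨z, rfl⟩ := hT₅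
    refine ⟨max z (max x' (x + 3)), ?_⟩
    ext ⟨a, b⟩
    simp only [hEdef, hD₃def, Finset.mem_union, Finset.mem_insert, mem_row, mem_col, Prod.mk.injEq]
    by_cases hab : (a, b) ∈ G
    · simp [hab]
    · have : ¬ (a = x ∧ b = y) := by rintro ⟨rfl, rfl⟩; exact hab hc
      simp only [hab, false_or]
      omega
  obtain rfl := hS₄.unique hfin (by omega)
  refine ⟨T, hT, hTk, ((((hr₂.trans hr₃).trans hr₄).trans
    ((((hq₁.trans hq₃).trans hq₄).trans hq₅).symm))).mono ?_⟩
  omega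

/-- Moving a line between cells of the environment whose distance is less than about half the
length of the line: the number of line moves is linear in the length. -/
lemma transport_short {G : Shape} {k l : ℕ} {c c' : Cell} (hG : Conn G) (hc : c ∈ G)
    (hc' : c' ∈ G) (h₁ : c.1 ≤ c'.1 + l) (h₂ : c'.1 ≤ c.1 + l) (h₃ : c.2 ≤ c'.2 + l)
    (h₄ : c'.2 ≤ c.2 + l) (hk : G.card + 2 * l + 8 ≤ k) :
    Transport (7 * (k - G.card)) G k c c' := by
  have same : ∀ {x x' y : ℕ}, (x, y) ∈ G → (x', y) ∈ G → x ≤ x' → x' ≤ x + l →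
      Transport (7 * (k - G.card)) G k (x, y) (x', y) := by
    intro x x' y hc hc' hx hl S hS hSk
    obtain ⟨T, hT, hTk⟩ := Ray.exists_card (E := G) (c := (x', y)) (k := k) (by omega)
    obtain ⟨T₁, hT₁, hl₁, hq₁⟩ := add_row_start hG hc' hT (x' - x) (by omega) (by omega)
    have hw₁ : x' - (x' - x) = x := by omega
    rw [hw₁] at hT₁
    have hB : row x x' y ⊆ S := by
      rintro ⟨a, b⟩ hab
      rw [mem_row] at hab
      obtain rfl : b = y := hab.2
      exact hS.mem (k := l) hc (by omega) hab.1.1 (by simp only; omega)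
    obtain rfl := (hS.absorb hB).unique hT₁ (by omega)
    exact ⟨T, hT, hTk, hq₁.symm.mono (by omega)⟩
  obtain ⟨x, y⟩ := c
  obtain ⟨x', y'⟩ := c'
  simp only at h₁ h₂ h₃ h₄
  rcases lt_trichotomy y y' with hy | rfl | hy
  · exact transport_up hG hc hc' hy h₁ h₂ h₄ hk
  · rcases le_total x x' with hx | hx
    · exact same hc hc' hx h₂
    · exact (same hc' hc hx h₁).symm (by omega)
  · exact (transport_up hG hc' hc hy h₂ h₁ h₃ hk).symm (by omega)

/-! ### Straightening a path -/

lemma near_walk {q : ℕ → Cell} {i m : ℕ} (h : ∀ t, i ≤ t → t < i + m → Near (q t) (q (t + 1))) :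
    (q i).1 ≤ (q (i + m)).1 + m ∧ (q (i + m)).1 ≤ (q i).1 + m ∧
      (q i).2 ≤ (q (i + m)).2 + m ∧ (q (i + m)).2 ≤ (q i).2 + m := by
  induction m with
  | zero => simp
  | succ m ih =>
    have h₁ := ih fun t ht ht' => h t ht (by omega)
    have h₂ := h (i + m) (by omega) (by omega)
    simp only [Near, add_assoc] at h₁ h₂ ⊢
    omega

/-- Moving a line of at least two cells along a walk in the environment. A long line takes steps
of about half its length, a short one follows the walk cell by cell; in either case the number of
line moves is linear in the lengths of the walk and of the line. -/
lemma transport_walk {G : Shape} {k : ℕ} (hG : Conn G) (hk : G.card + 2 ≤ k) {q : ℕ → Cell}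
    {i m : ℕ} (hq : ∀ t, i ≤ t → t ≤ i + m → q t ∈ G)
    (h : ∀ t, i ≤ t → t < i + m → Near (q t) (q (t + 1))) :
    Transport (77 * m + 7 * (k - G.card)) G k (q i) (q (i + m)) := by
  rcases Nat.lt_or_ge (k - G.card) 10 with ha | ha
  · suffices Transport (19 * m) G k (q i) (q (i + m)) from this.mono (by omega)
    induction m with
    | zero => exact fun S hS hSk => ⟨S, hS, hSk, .refl _ (hS.conn hG (hq i le_rfl le_rfl))⟩
    | succ m ih =>
      have h₁ := ih (fun t h₁ h₂ => hq t h₁ (by omega)) fun t h₁ h₂ => h t h₁ (by omega)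
      have h₂ := transport_near hG (hq (i + m) (by omega) (by omega))
        (hq (i + m + 1) (by omega) (by omega)) (h (i + m) (by omega) (by omega)) hk
      exact (h₁.trans h₂).mono (by omega)
  · obtain ⟨l, hl, hl', hl₁⟩ : ∃ l, 2 * l + 8 ≤ k - G.card ∧ k - G.card ≤ 2 * l + 9 ∧ 1 ≤ l :=
      ⟨(k - G.card - 8) / 2, by omega, by omega, by omega⟩
    induction m using Nat.strong_induction_on generalizing i with
    | _ m ih =>
      have short : ∀ {i n : ℕ}, n ≤ l → q i ∈ G → q (i + n) ∈ G →
          (∀ t, i ≤ t → t < i + n → Near (q t) (q (t + 1))) →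
          Transport (7 * (k - G.card)) G k (q i) (q (i + n)) := by
        intro i n hn h₁ h₂ h₃
        have := near_walk h₃
        exact transport_short (l := l) hG h₁ h₂ (by omega) (by omega) (by omega) (by omega)
          (by omega)
      rcases Nat.lt_or_ge l m with hlm | hlm
      · have h₁ := short (i := i) (n := l) le_rfl (hq _ (by omega) (by omega))
          (hq _ (by omega) (by omega)) fun t h₁ h₂ => h t h₁ (by omega)
        have h₂ := ih (m - l) (by omega) (i := i + l) (fun t h₁ h₂ => hq t (by omega) (by omega))
          fun t h₁ h₂ => h t (by omega) (by omega)
        rw [show i + l + (m - l) = i + m by omega] at h₂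
        exact (h₁.trans h₂).mono (by omega)
      · exact (short hlm (hq _ (by omega) (by omega)) (hq _ (by omega) le_rfl) h).mono (by omega)

/-- The cells `q t` with `i ≤ t < j`. -/
def walkCells (q : ℕ → Cell) (i j : ℕ) : Shape := (Finset.Ico i j).image q

lemma mem_walkCells {q : ℕ → Cell} {i j t : ℕ} (h : i ≤ t) (h' : t < j) :
    q t ∈ walkCells q i j :=
  Finset.mem_image_of_mem q (Finset.mem_Ico.2 ⟨h, h'⟩)

lemma walkCells_append (q : ℕ → Cell) {i j k : ℕ} (h : i ≤ j) (h' : j ≤ k) :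
    walkCells q i j ∪ walkCells q j k = walkCells q i k := by
  rw [walkCells, walkCells, ← Finset.image_union, Finset.Ico_union_Ico_eq_Ico h h', walkCells]

lemma walkCells_succ (q : ℕ → Cell) (i : ℕ) : walkCells q i (i + 1) = {q i} := by
  simp [walkCells]

lemma card_walkCells_le (q : ℕ → Cell) (i j : ℕ) : (walkCells q i j).card ≤ j - i :=
  Finset.card_image_le.trans (by simp)

lemma conn_union_walkCells {F : Shape} {q : ℕ → Cell} {i m : ℕ} (hF : Conn F)
    (hend : q (i + m) ∈ F) (h : ∀ t, i ≤ t → t < i + m → Near (q t) (q (t + 1))) :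
    Conn (F ∪ walkCells q i (i + m)) := by
  induction m generalizing i with
  | zero => simpa [walkCells] using hF
  | succ m ih =>
    have h₁ := ih (i := i + 1) (by rwa [add_assoc, add_comm 1]) fun t h₁ h₂ =>
      h t (by omega) (by omega)
    rw [show i + 1 + m = i + (m + 1) by omega] at h₁
    rw [← walkCells_append q (j := i + 1) (by omega) (by omega), walkCells_succ,
      Finset.union_left_comm, ← Finset.insert_eq]
    have hmem : q (i + 1) ∈ F ∪ walkCells q (i + 1) (i + (m + 1)) := by
      rcases Nat.eq_zero_or_pos m with rfl | hm
      · exact Finset.mem_union_left _ hend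
      · exact Finset.mem_union_right _ (mem_walkCells le_rfl (by omega))
    exact h₁.insert hmem (h i le_rfl (by omega))

/-- Divide and conquer.  A line of two spare cells at the start of a walk of length at most `2 ^ e`
swallows all cells of the walk outside the environment `F`, which contains the end of the walk, and
ends up as a line that starts at the end of the walk.  After the first half of the walk has been
swallowed, the line is moved along the second half, where all but two of its cells remain and
count as environment from then on, and these two return for the second half. -/
lemma straighten_walk {q : ℕ → Cell} (e : ℕ) {F S : Shape} {i m : ℕ} (hF : Conn F)
    (hm : m ≤ 2 ^ e) (hend : q (i + m) ∈ F)
    (h : ∀ t, i ≤ t → t < i + m → Near (q t) (q (t + 1)))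
    (hS : Ray (F ∪ walkCells q i (i + m)) (q i) S)
    (hcard : S.card = (F ∪ walkCells q i (i + m)).card + 2) :
    ∃ S', Ray F (q (i + m)) S' ∧ S'.card = S.card ∧ Reach (100 * (e + 1) * 2 ^ e) S S' := by
  -- the two transports and the two recursive calls for `e + 1` cost `2 * f e + 189 * 2 ^ e` moves
  -- at most, where `f e` is the bound for `e`
  induction e generalizing F S i m with
  | zero =>
    rcases Nat.eq_zero_or_pos m with rfl | hm0
    · have hwalk : F ∪ walkCells q i (i + 0) = F := by simp [walkCells]
      rw [hwalk] at hS
      exact ⟨S, hS, rfl, .refl _ (hS.conn hF hend)⟩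
    · obtain rfl : m = 1 := by simp at hm; omega
      have hwalk : F ∪ walkCells q i (i + 1) = insert (q i) F := by
        rw [walkCells_succ, Finset.union_comm, ← Finset.insert_eq]
      rw [hwalk] at hS hcard
      have hnear := h i le_rfl (by omega)
      by_cases hq : q i ∈ F
      · rw [Finset.insert_eq_of_mem hq] at hS hcard
        obtain ⟨S', hS', hk', hr⟩ := transport_near hF hq hend hnear hcard.ge S hS rfl
        exact ⟨S', hS', hk', hr.mono (by omega)⟩
      · rw [Finset.card_insert_of_notMem hq] at hcard
        obtain ⟨S', hS', hk', hr⟩ := absorb_start hF hq hend hnear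
          (Ray.of_insert hS le_rfl fun t h₁ h₂ => by omega) (by omega)
        exact ⟨S', hS', hk', hr.mono (by omega)⟩
  | succ e ih =>
    have hpow : 2 ^ (e + 1) = 2 * 2 ^ e := by rw [pow_succ]; ring
    have hmul : 100 * (e + 1 + 1) * 2 ^ (e + 1) =
        100 * (e + 1) * 2 ^ e + 100 * (e + 1) * 2 ^ e + 200 * 2 ^ e := by rw [hpow]; ring
    have hpos : 1 ≤ 2 ^ e := Nat.one_le_two_pow
    rcases Nat.lt_or_ge (2 ^ e) m with hlt | hle
    swap
    · obtain ⟨S', hS', hk', hr⟩ := ih hF hle hend h hS hcard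
      exact ⟨S', hS', hk', hr.mono (by omega)⟩
    obtain ⟨n, rfl⟩ : ∃ n, m = 2 ^ e + n := ⟨m - 2 ^ e, by omega⟩
    set j := i + 2 ^ e with hj
    have hend' : i + (2 ^ e + n) = j + n := by omega
    rw [hend'] at hend hS hcard ⊢
    have hG : Conn (F ∪ walkCells q j (j + n)) :=
      conn_union_walkCells hF hend fun t h₁ h₂ => h t (by omega) (by omega)
    have hGmem : ∀ t, j ≤ t → t ≤ j + n → q t ∈ F ∪ walkCells q j (j + n) := by
      intro t h₁ h₂
      rcases h₂.eq_or_lt with rfl | h₂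
      · exact Finset.mem_union_left _ hend
      · exact Finset.mem_union_right _ (mem_walkCells h₁ h₂)
    set G := F ∪ walkCells q j (j + n) with hGdef
    have hsplit : F ∪ walkCells q i (j + n) = G ∪ walkCells q i j := by
      rw [hGdef, ← walkCells_append q (j := j) (by omega) (by omega), Finset.union_right_comm,
        Finset.union_assoc]
    rw [hsplit] at hS hcard
    have hcard_le : S.card ≤ G.card + 2 ^ e + 2 := by
      have h₁ := Finset.card_union_le G (walkCells q i j)
      have h₂ := card_walkCells_le q i j
      omega
    have hcard_ge : G.card + 2 ≤ S.card := by
      have := Finset.card_le_card (Finset.subset_union_left (s₁ := G) (s₂ := walkCells q i j))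
      omega
    obtain ⟨S₁, hS₁, hk₁, hr₁⟩ := ih hG le_rfl (hGmem j le_rfl (by omega))
      (fun t h₁ h₂ => h t h₁ (by omega)) hS hcard
    obtain ⟨S₂, hS₂, hk₂, hr₂⟩ := transport_walk hG hcard_ge hGmem
      (fun t h₁ h₂ => h t (by omega) (by omega)) S₁ hS₁ hk₁
    -- `T` consists of all but two of the cells of the line that now starts at the end of the walk
    obtain ⟨T, hT, hTk⟩ := Ray.exists_card (E := G) (c := q (j + n)) (k := S.card - 2) (by omega)
    have hTc : Conn T := hT.conn hG (hGmem _ (by omega) le_rfl)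
    have hTS : T ⊆ S₂ := hT.subset_of_card_le hS₂ (by omega)
    have hS₂T : Ray T (q (j + n)) S₂ := by
      have := hS₂.absorb hTS
      rwa [Finset.union_eq_right.2 hT.subset] at this
    obtain ⟨S₃, hS₃, hk₃, hr₃⟩ := ((transport_walk (k := S.card) hTc (by omega)
      (fun t h₁ h₂ => hT.subset (hGmem t h₁ h₂))
      (fun t h₁ h₂ => h t (by omega) (by omega))).symm (by omega)) S₂ hS₂T hk₂
    obtain ⟨z, hz⟩ := hT
    have hTF : T = (F ∪ row (q (j + n)).1 z (q (j + n)).2) ∪ walkCells q j (j + n) := by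
      rw [hz, hGdef, Finset.union_right_comm]
    have hF' : Conn (F ∪ row (q (j + n)).1 z (q (j + n)).2) := hF.union_row hend fun _ => .refl _
    rw [hTF] at hS₃
    obtain ⟨S₄, hS₄, hk₄, hr₄⟩ := ih hF' (by omega) (Finset.mem_union_left _ hend)
      (fun t h₁ h₂ => h t (by omega) (by omega)) hS₃ (by rw [← hTF]; omega)
    refine ⟨S₄, ?_, by omega, (((hr₁.trans hr₂).trans hr₃).trans hr₄).mono (by omega)⟩
    obtain ⟨z', rfl⟩ := hS₄
    refine ⟨max z z', ?_⟩
    rw [Finset.union_assoc]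
    congr 1
    ext ⟨a, b⟩
    simp only [Finset.mem_union, mem_row]
    omega

/-! ### Forming a line from the first two cells of a path -/

/-- Two cells outside `F` are merged into the row of `(x + 1, r) ∈ F`: the cell to the left of
`(x + 1, r)` is pushed through that row first, so that the other cell can then be merged. -/
lemma push_pair {F : Shape} {x r t r' : ℕ} (hF : Conn F) (hf : (x + 1, r) ∈ F)
    (hs : (x, r) ∉ F) (ht : (t, r') ∉ F) (hr : r' = r + 1 ∨ r = r' + 1) (htx : t = x ∨ t = x + 1) :
    ∃ S', Ray F (x + 1, r) S' ∧ S'.card = F.card + 2 ∧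
      Reach 5 (insert (x, r) (insert (t, r') F)) S' := by
  have hE : Conn (insert (t, r') F) := hF.insert hf (by simp only [Near]; omega)
  have hs' : (x, r) ∉ insert (t, r') F := by simp [hs]; omega
  have hray : Ray (insert (t, r') F) (x, r) (insert (x, r) (insert (t, r') F)) :=
    (Ray.refl _ _).of_insert le_rfl fun i h₁ h₂ => by omega
  have hcard : (insert (x, r) (insert (t, r') F)).card = F.card + 2 := by
    rw [Finset.card_insert_of_notMem hs', Finset.card_insert_of_notMem ht]
  obtain ⟨S₁, hS₁, hk₁, hr₁⟩ := transport_slide hE (Finset.mem_insert_of_mem hf)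
    (by simp only [Near]; omega) (by simp only [Near]; omega) _ hray hcard
  obtain ⟨z, hz, hzE, hzS⟩ := hS₁.last (by
    rw [hk₁, Finset.card_insert_of_notMem ht]; omega)
  simp only at hz hzE hzS
  have hz1 : x + 1 ≠ z := by
    rintro rfl; exact hzE (Finset.mem_insert_of_mem hf)
  have hT : Conn (F ∪ row (x + 1) (z + 1) r) := hF.union_row hf fun _ => .refl _
  have htT : (t, r') ∉ F ∪ row (x + 1) (z + 1) r := by
    rw [Finset.mem_union, mem_row]; rintro (h | h); exacts [ht h, by omega]
  have hS₁' : S₁ = insert (t, r') (F ∪ row (x + 1) (z + 1) r) := by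
    rw [hzS, Finset.insert_union]
  have hray₁ : Ray (F ∪ row (x + 1) (z + 1) r) (t, r') S₁ := by
    rw [hS₁']; exact (Ray.refl _ _).of_insert le_rfl fun i h₁ h₂ => by omega
  have hTcard : (F ∪ row (x + 1) (z + 1) r).card + 1 = F.card + 2 := by
    rw [← hk₁, hS₁', Finset.card_insert_of_notMem htT]
  have hray₂ : ∃ S₂, Ray (F ∪ row (x + 1) (z + 1) r) (x + 1, r') S₂ ∧ S₂.card = F.card + 2 ∧
      Reach 1 S₁ S₂ := by
    rcases htx with rfl | rfl
    · exact transport_slide hT (Finset.mem_union_left _ hf) (by simp only [Near]; omega)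
        (by simp only [Near]; omega) S₁ hray₁ hk₁
    · exact ⟨S₁, hray₁, hk₁, .refl _ hr₁.conn_right⟩
  obtain ⟨S₂, hS₂, hk₂, hr₂⟩ := hray₂
  obtain ⟨S₃, hS₃, hk₃, hr₃⟩ := merge_straight_aux hT (Finset.mem_union_left _ hf)
    (Finset.mem_union_right _ (mem_row.2 (by omega))) hr hS₂
  refine ⟨S₃, ?_, hk₃.trans hk₂, ((hr₁.trans hr₂).trans hr₃).mono (by omega)⟩
  obtain ⟨z', rfl⟩ := hS₃
  refine ⟨max (z + 1) z', ?_⟩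
  rw [Finset.union_assoc]
  congr 1
  ext ⟨a, b⟩
  simp only [Finset.mem_union, mem_row]
  omega

/-- Two cells side by side, the left one attached to `F`, are a line already. -/
lemma pair_east {F : Shape} {x y : ℕ} {c : Cell} (hF : Conn F) (hc : c ∈ F)
    (hn : Near (x, y) c) (h : (x, y) ∉ F) (h' : (x + 1, y) ∉ F) :
    ∃ S', Ray F c S' ∧ S'.card = F.card + 2 ∧
      Reach 6 (insert (x + 1, y) (insert (x, y) F)) S' := by
  have hcard : (insert (x + 1, y) (insert (x, y) F)).card = F.card + 2 := by
    rw [Finset.card_insert_of_notMem (by simp [h']), Finset.card_insert_of_notMem h]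
  have hray : Ray F (x, y) (insert (x + 1, y) (insert (x, y) F)) := by
    refine ⟨x + 2, ?_⟩
    ext ⟨a, b⟩
    simp only [Finset.mem_insert, Finset.mem_union, mem_row, Prod.mk.injEq]
    grind
  obtain ⟨S', hS', hk, hr⟩ := absorb_start hF h hc hn hray (by omega)
  exact ⟨S', hS', by omega, hr.mono (by omega)⟩

/-- The cell `(x + 1, b)` moves to `(x + 1, y)`, unless that cell belongs to `F`. -/
lemma pair_northeast {F : Shape} {x y b : ℕ} {c : Cell} (hF : Conn F) (hc : c ∈ F)
    (hn : Near (x, y) c) (h : (x, y) ∉ F) (hb : b = y + 1 ∨ y = b + 1) (h' : (x + 1, b) ∉ F) :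
    ∃ f ∈ F, ∃ S', Ray F f S' ∧ S'.card = F.card + 2 ∧
      Reach 7 (insert (x + 1, b) (insert (x, y) F)) S' := by
  have hE : Conn (insert (x, y) F) := hF.insert hc hn
  by_cases hf : (x + 1, y) ∈ F
  · obtain ⟨S', hS', hk, hr⟩ := push_pair hF hf h h' hb (.inr rfl)
    rw [Finset.insert_comm] at hr
    exact ⟨_, hf, S', hS', hk, hr.mono (by omega)⟩
  · obtain ⟨S', hS', hk, hr⟩ := pair_east hF hc hn h hf
    have hu : (x + 1, b) ∉ insert (x, y) F := by simp [h']
    have h₁ : Reach 1 (insert (x + 1, b) (insert (x, y) F))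
        (insert (x + 1, y) ((insert (x + 1, b) (insert (x, y) F)).erase (x + 1, b))) := by
      refine .of_shift (hE.insert (a := (x, y)) (by simp) (by simp only [Near]; omega))
        (shift_col (by simp) (by simp [hf]; omega) fun t ht => by omega) ?_
      rw [Finset.erase_insert hu]
      exact hE.insert (a := (x, y)) (by simp) (by simp only [Near]; omega)
    rw [Finset.erase_insert hu] at h₁
    exact ⟨c, hc, S', hS', hk, (h₁.trans hr).mono (by omega)⟩

/-- The cell `(x, b)` moves one column to the right, unless it is blocked by a cell of `F`. -/
lemma pair_north {F : Shape} {x y b : ℕ} {c : Cell} (hF : Conn F) (hc : c ∈ F)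
    (hn : Near (x, y) c) (h : (x, y) ∉ F) (hb : b = y + 1 ∨ y = b + 1) (h' : (x, b) ∉ F) :
    ∃ f ∈ F, ∃ S', Ray F f S' ∧ S'.card = F.card + 2 ∧
      Reach 8 (insert (x, b) (insert (x, y) F)) S' := by
  have hE : Conn (insert (x, y) F) := hF.insert hc hn
  by_cases hf : (x + 1, b) ∈ F
  · obtain ⟨S', hS', hk, hr⟩ := push_pair hF hf h' h hb.symm (.inl rfl)
    exact ⟨_, hf, S', hS', hk, hr.mono (by omega)⟩
  · obtain ⟨f, hfF, S', hS', hk, hr⟩ := pair_northeast hF hc hn h hb hf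
    have hu : (x, b) ∉ insert (x, y) F := by simp [h']; omega
    have h₁ : Reach 1 (insert (x, b) (insert (x, y) F))
        (insert (x + 1, b) ((insert (x, b) (insert (x, y) F)).erase (x, b))) := by
      refine .of_shift (hE.insert (a := (x, y)) (by simp) (by simp only [Near]; omega))
        (shift_row (by simp) (by simp [hf]) fun t ht => by omega) ?_
      rw [Finset.erase_insert hu]
      exact hE.insert (a := (x, y)) (by simp) (by simp only [Near]; omega)
    rw [Finset.erase_insert hu] at h₁
    exact ⟨f, hfF, S', hS', hk, (h₁.trans hr).mono (by omega)⟩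

/-- The cell `(x, b)` moves one column to the right, unless it is blocked by a cell of `F`. -/
lemma pair_northwest {F : Shape} {x y b : ℕ} {c : Cell} (hF : Conn F) (hc : c ∈ F)
    (hn : Near (x + 1, y) c) (h : (x + 1, y) ∉ F) (hb : b = y + 1 ∨ y = b + 1) (h' : (x, b) ∉ F) :
    ∃ f ∈ F, ∃ S', Ray F f S' ∧ S'.card = F.card + 2 ∧
      Reach 9 (insert (x, b) (insert (x + 1, y) F)) S' := by
  have hE : Conn (insert (x + 1, y) F) := hF.insert hc hn
  by_cases hf : (x + 1, b) ∈ F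
  · obtain ⟨S', hS', hk, hr⟩ := push_pair hF hf h' h hb.symm (.inr rfl)
    exact ⟨_, hf, S', hS', hk, hr.mono (by omega)⟩
  · obtain ⟨f, hfF, S', hS', hk, hr⟩ := pair_north hF hc hn h hb hf
    have hu : (x, b) ∉ insert (x + 1, y) F := by simp [h']
    have h₁ : Reach 1 (insert (x, b) (insert (x + 1, y) F))
        (insert (x + 1, b) ((insert (x, b) (insert (x + 1, y) F)).erase (x, b))) := by
      refine .of_shift (hE.insert (a := (x + 1, y)) (by simp) (by simp only [Near]; omega))
        (shift_row (by simp) (by simp [hf]; omega) fun t ht => by omega) ?_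
      rw [Finset.erase_insert hu]
      exact hE.insert (a := (x + 1, y)) (by simp) (by simp only [Near]; omega)
    rw [Finset.erase_insert hu] at h₁
    exact ⟨f, hfF, S', hS', hk, (h₁.trans hr).mono (by omega)⟩

/-- Two cells `u₂`, `u₁` attached as a tail to `F` are turned into a line through a cell of `F`. -/
lemma exists_line_of_pair {F : Shape} {u₁ u₂ c : Cell} (hF : Conn F) (hc : c ∈ F)
    (hn : Near u₂ c) (hn' : Near u₁ u₂) (hne : u₁ ≠ u₂) (h₁ : u₁ ∉ F) (h₂ : u₂ ∉ F) :
    ∃ f ∈ F, ∃ S', Ray F f S' ∧ S'.card = F.card + 2 ∧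
      Reach 9 (insert u₁ (insert u₂ F)) S' := by
  obtain ⟨a, b⟩ := u₁
  obtain ⟨x, y⟩ := u₂
  simp only [Near] at hn'
  simp only [ne_eq, Prod.mk.injEq, not_and] at hne
  by_cases hby : b = y
  · subst hby
    obtain rfl | rfl : a = x + 1 ∨ x = a + 1 := by omega
    · obtain ⟨S', hS', hk, hr⟩ := pair_east hF hc hn h₂ h₁
      exact ⟨c, hc, S', hS', hk, hr.mono (by omega)⟩
    · have hE : Conn (insert (a + 1, b) F) := hF.insert hc hn
      have hray : Ray (insert (a + 1, b) F) (a, b) (insert (a, b) (insert (a + 1, b) F)) :=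
        (Ray.refl _ _).of_insert le_rfl fun i h₁ h₂ => by omega
      have hcard : (insert (a, b) (insert (a + 1, b) F)).card = F.card + 2 := by
        rw [Finset.card_insert_of_notMem (by simp [h₁]), Finset.card_insert_of_notMem h₂]
      obtain ⟨S₁, hS₁, hk₁, hr₁⟩ := transport_slide hE (Finset.mem_insert_self _ _)
        (by simp only [Near]; omega) (.refl _) _ hray hcard
      obtain ⟨S', hS', hk, hr⟩ := absorb_start hF h₂ hc hn
        (hS₁.of_insert le_rfl fun i h₁ h₂ => by omega) (by omega)
      exact ⟨c, hc, S', hS', by omega, (hr₁.trans hr).mono (by omega)⟩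
  · have hb : b = y + 1 ∨ y = b + 1 := by omega
    obtain rfl | rfl | rfl : a = x + 1 ∨ a = x ∨ x = a + 1 := by omega
    · obtain ⟨f, hf, S', hS', hk, hr⟩ := pair_northeast hF hc hn h₂ hb h₁
      exact ⟨f, hf, S', hS', hk, hr.mono (by omega)⟩
    · obtain ⟨f, hf, S', hS', hk, hr⟩ := pair_north hF hc hn h₂ hb h₁
      exact ⟨f, hf, S', hS', hk, hr.mono (by omega)⟩
    · exact pair_northwest hF hc hn h₂ hb h₁

/-- A shape of two near cells is turned into a horizontal line. -/
lemma exists_line_of_two {u v : Cell} (hn : Near u v) (hne : u ≠ v) :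
    ∃ c ∈ ({u, v} : Shape), ∃ S', Ray {c} c S' ∧ Reach 3 {u, v} S' := by
  -- the case in which the first cell is not to the left of the second one
  have key : ∀ {a b x y : ℕ}, Near (a, b) (x, y) → (a, b) ≠ (x, y) → (a = x ∨ a = x + 1) →
      ∃ S', Ray {(x, y)} (x, y) S' ∧ Reach 3 {(a, b), (x, y)} S' := by
    intro a b x y hn hne hax
    simp only [Near] at hn
    simp only [ne_eq, Prod.mk.injEq, not_and] at hne
    have hray : Ray {(x, y)} (a, b) {(a, b), (x, y)} :=
      (Ray.refl _ _).of_insert le_rfl fun i h₁ h₂ => by omega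
    have hcard : ({(a, b), (x, y)} : Shape).card = 2 :=
      Finset.card_pair (by simpa using hne)
    have hE := conn_singleton (x, y)
    have hx := Finset.mem_singleton_self ((x, y) : Cell)
    have hconn : Conn {(a, b), (x, y)} := hE.insert hx (by simp only [Near]; omega)
    have h₁ : ∃ S₁, Ray {(x, y)} (x + 1, b) S₁ ∧ S₁.card = 2 ∧ Reach 1 {(a, b), (x, y)} S₁ := by
      rcases hax with rfl | rfl
      · exact transport_slide hE hx (by simp only [Near]; omega) (by simp only [Near]; omega) _
          hray hcard
      · exact ⟨_, hray, hcard, .refl _ hconn⟩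
    obtain ⟨S₁, hS₁, hk₁, hr₁⟩ := h₁
    by_cases hby : b = y
    · subst hby
      exact ⟨S₁, (ray_succ_iff hx).1 hS₁, hr₁.mono (by omega)⟩
    · obtain ⟨S₂, hS₂, hk₂, hr₂⟩ := merge_left hE hx (by omega) (by simp) hS₁
      refine ⟨S₂, hS₂, (hr₁.trans hr₂).mono ?_⟩
      rw [Finset.card_singleton]; omega
  obtain ⟨a, b⟩ := u
  obtain ⟨x, y⟩ := v
  have hn₁ := hn
  simp only [Near] at hn₁
  by_cases hax : a = x ∨ a = x + 1
  · obtain ⟨S', hS', hr⟩ := key hn hne hax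
    exact ⟨_, by simp, S', hS', hr⟩
  · obtain ⟨S', hS', hr⟩ := key hn.symm hne.symm (by omega)
    exact ⟨(a, b), by simp, S', hS', by rwa [Finset.pair_comm]⟩

/-- A path of `n` cells is straightened into a horizontal line that starts in one of its cells. -/
lemma straighten {q : ℕ → Cell} {n e : ℕ} (hn : 2 ≤ n) (hcard : (walkCells q 0 n).card = n)
    (h : ∀ t, t + 1 < n → Near (q t) (q (t + 1))) (he : n ≤ 2 ^ e) :
    ∃ c ∈ walkCells q 0 n, ∃ S', Ray {c} c S' ∧
      Reach (23 + 77 * n + 100 * (e + 1) * 2 ^ e) (walkCells q 0 n) S' := by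
  have hinj : Set.InjOn q (Finset.Ico 0 n : Finset ℕ) := by
    apply Finset.card_image_iff.1
    simpa [walkCells] using hcard
  have hne : ∀ s t, s < n → t < n → q s = q t → s = t := fun s t hs ht hst =>
    hinj (by simpa using hs) (by simpa using ht) hst
  rcases hn.eq_or_lt with rfl | hn
  · have hS : walkCells q 0 2 = {q 0, q 1} := by
      rw [← walkCells_append q (j := 1) (by omega) (by omega), walkCells_succ q 0,
        walkCells_succ q 1, Finset.insert_eq]
    rw [hS]
    obtain ⟨c, hc, S', hS', hr⟩ := exists_line_of_two (h 0 (by omega))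
      fun hq => by simpa using hne 0 1 (by omega) (by omega) hq
    exact ⟨c, hc, S', hS', hr.mono (by omega)⟩
  · obtain ⟨m, rfl⟩ : ∃ m, n = 2 + m + 1 := ⟨n - 3, by omega⟩
    have hF : {q (2 + m)} ∪ walkCells q 2 (2 + m) = walkCells q 2 (2 + m + 1) := by
      rw [Finset.union_comm, ← walkCells_succ, walkCells_append q (by omega) (by omega)]
    have hFc : Conn (walkCells q 2 (2 + m + 1)) := by
      rw [← hF]
      exact conn_union_walkCells (conn_singleton _) (Finset.mem_singleton_self _)
        fun t _ _ => h t (by omega)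
    have hS : walkCells q 0 (2 + m + 1) =
        insert (q 0) (insert (q 1) (walkCells q 2 (2 + m + 1))) := by
      rw [← walkCells_append q (i := 0) (j := 1) (by omega) (by omega),
        ← walkCells_append q (i := 1) (j := 2) (by omega) (by omega), walkCells_succ q 0,
        walkCells_succ q 1, Finset.insert_eq, Finset.insert_eq]
    have hnot : ∀ s, s < 2 → q s ∉ walkCells q 2 (2 + m + 1) := by
      intro s hs hmem
      obtain ⟨t, ht, hst⟩ := Finset.mem_image.1 hmem
      rw [Finset.mem_Ico] at ht
      have := hne t s (by omega) (by omega) hst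
      omega
    obtain ⟨f, hf, S₁, hS₁, hk₁, hr₁⟩ := exists_line_of_pair hFc
      (mem_walkCells le_rfl (by omega)) (h 1 (by omega)) (h 0 (by omega))
      (fun hq => by simpa using hne 0 1 (by omega) (by omega) hq) (hnot 0 (by omega))
      (hnot 1 (by omega))
    rw [← hS] at hr₁
    obtain ⟨j, hj, rfl⟩ := Finset.mem_image.1 hf
    rw [Finset.mem_Ico] at hj
    obtain ⟨i, rfl⟩ : ∃ i, j = 2 + i := ⟨j - 2, by omega⟩
    obtain ⟨S₂, hS₂, hk₂, hr₂⟩ := (transport_walk hFc le_rfl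
      (fun t h₁ h₂ => mem_walkCells h₁ (by omega)) fun t h₁ h₂ => h t (by omega)).symm (by omega)
      S₁ hS₁ hk₁
    rw [← hF] at hS₂ hk₂
    have hmem := Finset.mem_singleton_self (q (2 + m))
    obtain ⟨S₃, hS₃, hk₃, hr₃⟩ := straighten_walk e (conn_singleton _) (by omega) hmem
      (fun t _ _ => h t (by omega)) hS₂ hk₂
    exact ⟨_, mem_walkCells (by omega) (by omega), S₃, hS₃,
      ((hr₁.trans hr₂).trans hr₃).mono (by omega)⟩

/-! ### Moving a straight line -/

lemma reach_row_right (x y n : ℕ) (hn : 1 ≤ n) (i : ℕ) :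
    Reach i (row x (x + n) y) (row (x + i) (x + i + n) y) := by
  induction i with
  | zero => exact .refl _ (conn_row (by omega))
  | succ i ih =>
    have heq : insert (x + i + n, y) ((row (x + i) (x + i + n) y).erase (x + i, y)) =
        row (x + (i + 1)) (x + (i + 1) + n) y := by
      ext ⟨a, b⟩
      simp only [Finset.mem_insert, Finset.mem_erase, mem_row, Prod.mk.injEq, ne_eq]
      omega
    have := Reach.step ih (shift_row (x := x + i) (x' := x + i + n) (y := y)
      (mem_row.2 (by omega)) (by rw [mem_row]; omega) fun t ht => mem_row.2 (by omega))
      (by rw [heq]; exact conn_row (by omega))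
    rwa [heq] at this

lemma reach_col_up (x y n : ℕ) (hn : 1 ≤ n) (i : ℕ) :
    Reach i (col x y (y + n)) (col x (y + i) (y + i + n)) := by
  induction i with
  | zero => exact .refl _ (conn_col (by omega))
  | succ i ih =>
    have heq : insert (x, y + i + n) ((col x (y + i) (y + i + n)).erase (x, y + i)) =
        col x (y + (i + 1)) (y + (i + 1) + n) := by
      ext ⟨a, b⟩
      simp only [Finset.mem_insert, Finset.mem_erase, mem_col, Prod.mk.injEq, ne_eq]
      omega
    have := Reach.step ih (shift_col (x := x) (y := y + i) (y' := y + i + n)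
      (mem_col.2 (by omega)) (by rw [mem_col]; omega) fun t ht => mem_col.2 (by omega))
      (by rw [heq]; exact conn_col (by omega))
    rwa [heq] at this

/-- A horizontal line is turned around its right end into a vertical one. -/
lemma reach_rotate (x y n : ℕ) :
    Reach (2 * n) (row x (x + n + 1) y) (col (x + n) y (y + n + 1)) := by
  have key : ∀ i ≤ n, Reach (2 * i) (row x (x + n + 1) y)
      (row (x + i) (x + n + 1) y ∪ col (x + n) y (y + i + 1)) := by
    intro i
    induction i with
    | zero =>
      intro _
      have : row (x + 0) (x + n + 1) y ∪ col (x + n) y (y + 0 + 1) = row x (x + n + 1) y := by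
        ext ⟨a, b⟩; simp only [Finset.mem_union, mem_row, mem_col]; omega
      rw [this]
      exact .refl _ (conn_row (by omega))
    | succ i ih =>
      intro hi
      have hr := ih (by omega)
      set P := row (x + i) (x + n + 1) y ∪ col (x + n) y (y + i + 1) with hP
      have hmem : ∀ a b, (a, b) ∈ P ↔ ((x + i ≤ a ∧ a < x + n + 1) ∧ b = y) ∨
          (a = x + n ∧ y ≤ b ∧ b < y + i + 1) := by
        intro a b; rw [hP, Finset.mem_union, mem_row, mem_col]
      have hu : (x + i, y) ∈ P := by rw [hmem]; omega
      have hj : (x + n, y) ∈ P := by rw [hmem]; omega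
      have hv : (x + n, y + i + 1) ∉ P := by rw [hmem]; omega
      have heq₁ : insert (x + n, y + i + 1) (P.erase (x + n, y)) =
          row (x + i) (x + n) y ∪ col (x + n) (y + 1) (y + i + 2) := by
        ext ⟨a, b⟩
        simp only [Finset.mem_insert, Finset.mem_erase, hmem, Finset.mem_union, mem_row, mem_col,
          Prod.mk.injEq, ne_eq]
        omega
      have heq₂ : insert (x + n, y + i + 1) (P.erase (x + i, y)) =
          row (x + (i + 1)) (x + n + 1) y ∪ col (x + n) y (y + (i + 1) + 1) := by
        ext ⟨a, b⟩
        simp only [Finset.mem_insert, Finset.mem_erase, hmem, Finset.mem_union, mem_row, mem_col,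
          Prod.mk.injEq, ne_eq]
        omega
      have hc₁ : Conn (insert (x + n, y + i + 1) (P.erase (x + n, y))) := by
        rw [heq₁]
        exact (conn_row (by omega)).union (a := (x + n - 1, y)) (b := (x + n, y + 1))
          (conn_col (by omega)) (mem_row.2 (by omega)) (mem_col.2 (by omega))
          (by simp only [Near]; omega)
      have hc₂ : Conn (insert (x + n, y + i + 1) (P.erase (x + i, y))) := by
        rw [heq₂]
        exact (conn_row (by omega)).union (a := (x + n, y)) (b := (x + n, y))
          (conn_col (by omega)) (mem_row.2 (by omega)) (mem_col.2 (by omega)) (.refl _)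
      have h₁ := Reach.of_shift hr.conn_right
        (shift_col hj hv fun t ht => (hmem _ _).2 (by omega)) hc₁
      have h₂ := Reach.flow hu hj hv h₁ (shift_row
        (mem_insert_erase (.inr ⟨by simp; omega, hu⟩)) (by simp; omega) fun t ht =>
          mem_insert_erase (.inr ⟨by simp; omega, (hmem _ _).2 (by omega)⟩)) hc₂
      rw [heq₂] at h₂
      exact hr.trans h₂
  have := key n le_rfl
  rwa [Finset.union_eq_right.2] at this
  rintro ⟨a, b⟩
  simp only [mem_row, mem_col]
  omega

/-- A horizontal line of length `n` moves to the right and up by at most `4 * n` line moves more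
than the distance: it climbs as a vertical line. -/
lemma reach_row {x y x' y' n : ℕ} (hn : 1 ≤ n) (hx : x ≤ x') (hy : y ≤ y') :
    Reach (4 * n + (x' - x) + (y' - y)) (row x (x + n) y) (row x' (x' + n) y') := by
  obtain ⟨n, rfl⟩ : ∃ m, n = m + 1 := ⟨n - 1, by omega⟩
  have h₁ := reach_row_right x y (n + 1) (by omega) (x' - x)
  rw [Nat.add_sub_cancel' hx] at h₁
  have h₂ := reach_rotate x' y n
  have h₃ := reach_col_up (x' + n) y (n + 1) (by omega) (y' - y)
  rw [Nat.add_sub_cancel' hy] at h₃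
  have h₄ := (reach_rotate x' y' n).symm
  simp only [add_assoc] at h₁ h₂ h₃ h₄ ⊢
  exact (((h₁.trans h₂).trans h₃).trans h₄).mono (by omega)

/-! ### Translations -/

lemma mem_translate {S : Shape} {s : Cell} {a b : ℕ} :
    (a, b) ∈ S.image (· + s) ↔ ∃ a' b', (a', b') ∈ S ∧ a = a' + s.1 ∧ b = b' + s.2 := by
  simp only [Finset.mem_image, Prod.exists, Prod.ext_iff, Prod.fst_add, Prod.snd_add]
  constructor
  · rintro ⟨a', b', h, rfl, rfl⟩; exact ⟨a', b', h, rfl, rfl⟩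
  · rintro ⟨a', b', h, rfl, rfl⟩; exact ⟨a', b', h, rfl, rfl⟩

lemma Conn.translate {S : Shape} (h : Conn S) (s : Cell) : Conn (S.image (· + s)) := by
  have key : ∀ u v, Linked S u v → Linked (S.image (· + s)) (u + s) (v + s) := by
    intro u v huv
    induction huv with
    | refl => exact .refl
    | tail _ hab ih =>
      refine ih.tail ⟨Finset.mem_image_of_mem _ hab.1, Finset.mem_image_of_mem _ hab.2.1, ?_⟩
      have := hab.2.2
      simp only [Near, Prod.fst_add, Prod.snd_add] at this ⊢
      omega
  refine ⟨h.1.image _, fun u hu v hv => ?_⟩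
  obtain ⟨u, hu', rfl⟩ := Finset.mem_image.1 hu
  obtain ⟨v, hv', rfl⟩ := Finset.mem_image.1 hv
  exact key u v (h.2 u hu' v hv')

lemma Shift.translate {S : Shape} {u v : Cell} (h : Shift S u v) (s : Cell) :
    Shift (S.image (· + s)) (u + s) (v + s) := by
  obtain ⟨hu, hv, h⟩ := h
  have hinj : Function.Injective (· + s : Cell → Cell) := add_left_injective s
  refine ⟨Finset.mem_image_of_mem _ hu, fun hmem => hv ((hinj.mem_finset_image).1 hmem), ?_⟩
  rcases h with ⟨h, hb⟩ | ⟨h, hb⟩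
  · refine .inl ⟨by simp [h], fun t ht => mem_translate.2 ⟨t - s.1, u.2, hb _ ?_, ?_, rfl⟩⟩
    · simp only [Prod.fst_add] at ht; omega
    · simp only [Prod.fst_add] at ht; omega
  · refine .inr ⟨by simp [h], fun t ht => mem_translate.2 ⟨u.1, t - s.2, hb _ ?_, rfl, ?_⟩⟩
    · simp only [Prod.snd_add] at ht; omega
    · simp only [Prod.snd_add] at ht; omega

lemma Reach.translate {m : ℕ} {A B : Shape} (h : Reach m A B) (s : Cell) :
    Reach m (A.image (· + s)) (B.image (· + s)) := by
  have hinj : Function.Injective (· + s : Cell → Cell) := add_left_injective s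
  induction h with
  | refl m hA => exact .refl m (hA.translate s)
  | @step m A B u v h hs hc ih =>
    have heq : (insert v (B.erase u)).image (· + s) =
        insert (v + s) ((B.image (· + s)).erase (u + s)) := by
      rw [Finset.image_insert, Finset.image_erase hinj]
    have hc' := hc.translate s
    rw [heq] at hc' ⊢
    exact .step ih (hs.translate s) hc'

lemma row_translate (x z y : ℕ) (s : Cell) :
    (row x z y).image (· + s) = row (x + s.1) (z + s.1) (y + s.2) := by
  ext ⟨a, b⟩
  rw [mem_translate, mem_row]
  constructor
  · rintro ⟨a', b', h, rfl, rfl⟩; rw [mem_row] at h; omega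
  · intro h; exact ⟨a - s.1, b - s.2, mem_row.2 (by omega), by omega, by omega⟩

/-! ### Hamiltonian shapes -/

lemma Ray.eq_row {S : Shape} {c : Cell} (h : Ray {c} c S) : S = row c.1 (c.1 + S.card) c.2 := by
  obtain ⟨z, hz⟩ := h
  have h₁ : S = row c.1 (max z (c.1 + 1)) c.2 := by
    rw [hz]
    ext ⟨a, b⟩
    simp only [Finset.mem_union, Finset.mem_singleton, mem_row, Prod.ext_iff]
    omega
  have h₂ : S.card = max z (c.1 + 1) - c.1 := by
    conv_lhs => rw [h₁]
    exact card_row _ _ _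
  rw [h₂, Nat.add_sub_cancel' (by omega)]
  exact h₁

lemma row_eq_hLine (x y n : ℕ) : row x (x + n) y = hLine x y n := by
  ext ⟨a, b⟩
  rw [mem_row, mem_hLine]
  omega

/-- The cells of a Hamiltonian shape in the order of a Hamiltonian path. -/
lemma exists_walk {S : Shape} (h : S.IsHamiltonianShape) :
    2 ≤ S.card ∧ ∃ q : ℕ → Cell, S = walkCells q 0 S.card ∧
      ∀ t, t + 1 < S.card → Near (q t) (q (t + 1)) := by
  obtain ⟨u, v, p, huv, hp⟩ := h
  have hlen : S.card = p.length + 1 := by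
    have := hp.length_eq
    rw [Fintype.card_coe] at this
    have hpos : 0 < S.card := Finset.card_pos.2 ⟨u, u.2⟩
    omega
  have hlen0 : p.length ≠ 0 := fun h0 => huv (SimpleGraph.Walk.eq_of_length_eq_zero h0)
  refine ⟨by omega, fun t => (p.getVert t).1, ?_, fun t ht => ?_⟩
  · ext c
    simp only [walkCells, Finset.mem_image, Finset.mem_Ico]
    constructor
    · intro hc
      obtain ⟨t, ht, htl⟩ := SimpleGraph.Walk.mem_support_iff_exists_getVert.1
        (hp.mem_support ⟨c, hc⟩)
      exact ⟨t, by omega, by rw [ht]⟩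
    · rintro ⟨t, _, rfl⟩
      exact (p.getVert t).2
  · exact (p.adj_getVert_succ (i := t) (by omega)).2

/-- Up to translation, a Hamiltonian shape of order `n` lies in a square of side length `n`. -/
lemma exists_walk_normalized {S : Shape} (h : S.IsHamiltonianShape) :
    ∃ (q : ℕ → Cell) (s : Cell), S = (walkCells q 0 S.card).image (· + s) ∧
      (walkCells q 0 S.card).card = S.card ∧
      (∀ t, t + 1 < S.card → Near (q t) (q (t + 1))) ∧
      ∀ c ∈ walkCells q 0 S.card, c.1 < S.card ∧ c.2 < S.card := by
  obtain ⟨hn, q, hq, hnear⟩ := exists_walk h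
  have hne : (Finset.range S.card).Nonempty := Finset.nonempty_range_iff.2 (by omega)
  obtain ⟨i, hi, hmini⟩ := Finset.exists_min_image (Finset.range S.card) (fun t => (q t).1) hne
  obtain ⟨j, hj, hminj⟩ := Finset.exists_min_image (Finset.range S.card) (fun t => (q t).2) hne
  simp only [Finset.mem_range] at hi hj hmini hminj
  have hS : S = (walkCells (fun t => ((q t).1 - (q i).1, (q t).2 - (q j).2)) 0 S.card).image
      (· + ((q i).1, (q j).2)) := by
    rw [walkCells, Finset.image_image]
    conv_lhs => rw [hq, walkCells]
    refine Finset.image_congr fun t ht => ?_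
    have ht' : t < S.card := by simpa using ht
    have h₁ := hmini t ht'
    have h₂ := hminj t ht'
    simp only [Function.comp, Prod.ext_iff, Prod.fst_add, Prod.snd_add]
    omega
  have hdist : ∀ s t, s < S.card → t < S.card →
      (q s).1 < (q t).1 + S.card ∧ (q s).2 < (q t).2 + S.card := by
    intro s t hs ht
    rcases le_total s t with hst | hst
    · obtain ⟨m, rfl⟩ := Nat.exists_eq_add_of_le hst
      have := near_walk (q := q) (i := s) (m := m) fun t h₁ h₂ => hnear t (by omega)
      omega
    · obtain ⟨m, rfl⟩ := Nat.exists_eq_add_of_le hst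
      have := near_walk (q := q) (i := t) (m := m) fun t h₁ h₂ => hnear t (by omega)
      omega
  refine ⟨_, _, hS, ?_, fun t ht => ?_, fun c hc => ?_⟩
  · conv_rhs => rw [hS]
    exact (Finset.card_image_of_injective _ (add_left_injective _)).symm
  · have h₁ := hmini t (by omega)
    have h₂ := hmini (t + 1) (by omega)
    have h₃ := hminj t (by omega)
    have h₄ := hminj (t + 1) (by omega)
    have := hnear t ht
    simp only [Near] at this ⊢
    omega
  · obtain ⟨t, ht, rfl⟩ := Finset.mem_image.1 hc
    have ht' : t < S.card := by simpa using ht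
    have h₁ := (hdist t i ht' hi).1
    have h₂ := (hdist t j ht' hj).2
    simp only
    omega

/-- The transformation of one Hamiltonian shape into another one, with an explicit bound. -/
lemma exists_reach {A B : Shape} {n e : ℕ} (hA : A.IsHamiltonianShape)
    (hB : B.IsHamiltonianShape) (hAn : A.card = n) (hBn : B.card = n) (he : n ≤ 2 ^ e) :
    ∃ L B' : Shape, L.IsStraightLine ∧ IsTranslate B B' ∧
      Reach (23 + 77 * n + 100 * (e + 1) * 2 ^ e) A L ∧
      Reach (6 * n + (23 + 77 * n + 100 * (e + 1) * 2 ^ e)) L B' := by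
  obtain ⟨hn, q, hq, hnear⟩ := exists_walk hA
  obtain ⟨q', s, hs, hcard', hnear', hbound⟩ := exists_walk_normalized hB
  rw [hAn] at hn hq hnear
  rw [hBn] at hs hcard' hnear' hbound
  obtain ⟨c, -, L, hL, hrL⟩ := straighten hn (hq ▸ hAn) hnear he
  obtain ⟨c', hc', L', hL', hrL'⟩ := straighten hn hcard' hnear' he
  rw [← hq] at hrL
  have hLcard : L.card = n := hrL.card.trans hAn
  have hLrow := hL.eq_row
  have hL'row := hL'.eq_row
  rw [hLcard] at hLrow
  rw [hrL'.card, hcard'] at hL'row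
  have hb := hbound c' hc'
  -- the line `L` and the translated line `L'` meet at the larger coordinates of their starts
  set d : Cell := (max c.1 c'.1 - c'.1, max c.2 c'.2 - c'.2) with hd
  have hmeet : L'.image (· + d) = row (max c.1 c'.1) (max c.1 c'.1 + n) (max c.2 c'.2) := by
    rw [hL'row, row_translate]
    congr 1 <;> simp only [hd] <;> omega
  have h₁ : Reach (6 * n) L (L'.image (· + d)) := by
    rw [hmeet, hLrow]
    exact (reach_row (by omega) (le_max_left _ _) (le_max_left _ _)).mono (by omega)
  refine ⟨L, (walkCells q' 0 n).image (· + d), ⟨c.1, c.2, .inl ?_⟩, ⟨d, s, ?_⟩, hrL,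
    h₁.trans (hrL'.translate d).symm⟩
  · rw [hLcard, ← row_eq_hLine]; exact hLrow
  · rw [hs, Finset.image_image, Finset.image_image]
    congr 1
    funext u
    simp only [Function.comp]
    exact add_right_comm u s d

lemma transformsThroughLine {A B : Shape} {n : ℕ} (hA : A.IsHamiltonianShape)
    (hB : B.IsHamiltonianShape) (hAn : A.card = n) (hBn : B.card = n) :
    TransformsThroughLine (2000 * ((n : ℝ) * Real.logb 2 (n : ℝ))) A B := by
  have hn : 2 ≤ n := hAn ▸ (exists_walk hA).1
  have he : n ≤ 2 ^ (Nat.log 2 n + 1) := (Nat.lt_pow_succ_log_self (by norm_num) n).le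
  obtain ⟨L, B', hL, hB', h₁, h₂⟩ := exists_reach hA hB hAn hBn he
  obtain ⟨m₁, hm₁, ht₁⟩ := h₁.connectedTransformation
  obtain ⟨m₂, hm₂, ht₂⟩ := h₂.connectedTransformation
  refine ⟨L, B', m₁, m₂, hL, hB', ht₁, ht₂, ?_⟩
  have hpow : 2 ^ (Nat.log 2 n + 1) ≤ 2 * n := by
    have := Nat.pow_log_le_self 2 (x := n) (by omega)
    rw [pow_succ]; omega
  have hle : m₁ + m₂ ≤ 46 + 160 * n + 400 * ((Nat.log 2 n + 2) * n) := by
    have : 100 * (Nat.log 2 n + 1 + 1) * 2 ^ (Nat.log 2 n + 1) ≤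
        100 * (Nat.log 2 n + 1 + 1) * (2 * n) := Nat.mul_le_mul_left _ hpow
    have h' : 100 * (Nat.log 2 n + 1 + 1) * (2 * n) = 200 * ((Nat.log 2 n + 2) * n) := by ring
    omega
  have hlog : (Nat.log 2 n : ℝ) ≤ Real.logb 2 n := by
    simpa using Real.natLog_le_logb n 2
  have hn' : (2 : ℝ) ≤ n := by exact_mod_cast hn
  have hlog1 : 1 ≤ Real.logb 2 n := by
    rw [Real.le_logb_iff_rpow_le (by norm_num) (by linarith)]
    simpa using hn'
  have hle' : ((m₁ + m₂ : ℕ) : ℝ) ≤ 46 + 160 * n + 400 * ((Nat.log 2 n + 2) * n) := by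
    exact_mod_cast hle
  have h₃ : (Nat.log 2 n + 2 : ℝ) * n ≤ 3 * (n * Real.logb 2 n) := by nlinarith
  have h₄ : (n : ℝ) ≤ n * Real.logb 2 n := by nlinarith
  linarith

end LineMoves

theorem mainTheorem1 :
    ∃ C : ℝ, ∀ (n : ℕ) (S_I S_F : Shape),
      S_I.IsHamiltonianShape → S_F.IsHamiltonianShape → S_I.card = n → S_F.card = n →
        TransformsThroughLine (C * ((n : ℝ) * Real.logb 2 (n : ℝ))) S_I S_F ∧
        TransformsThroughLine (C * ((n : ℝ) * Real.logb 2 (n : ℝ))) S_F S_I :=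
  ⟨2000, fun _ _ _ hI hF hIn hFn => ⟨LineMoves.transformsThroughLine hI hF hIn hFn,
    LineMoves.transformsThroughLine hF hI hFn hIn⟩⟩
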